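/- Let $d_A,d_B,d_C,d_D$ be integers with $3\le d_A\le d_B\le d_C\le d_D$, and let $s$ be an integer with $0\le s\le\lfloor (d_A-3)/2\rfloor$. Then there exists a strongly nonlocal unextendible product basis $\mathcal U\subset\mathbb C^{d_A}\otimes\mathbb C^{d_B}\otimes\mathbb C^{d_C}\otimes\mathbb C^{d_D}$ with exactly $d_Ad_Bd_Cd_D-16(s+1)$ elements. Here states are nonzero vectors, not necessarily normalized. An unextendible product basis is a finite set of mutually orthogonal product states $|a\rangle|b\rangle|c\rangle|e\rangle$ which does not span the whole space and such that the orthogonal complement of its span contains no product state. Such a set is strongly nonlocal if it is locally irreducible in each of the seven bipartitions of the parties $A,B,C,D$ into two nonempty groups. Locally irreducible in a bipartition means that it is impossible to eliminate one or more (but not all) of the states by a finite sequence of orthogonality-preserving local measurements, possibly chosen adaptively, where each measurement is performed by one of the two groups acting jointly. A local measurement by a group consists of finitely many operators $M_k$ on the joint space of that group with $\sum_k M_k^\dagger M_k=\mathbb I$, and it takes each state $|\psi\rangle$ to $(M_k\otimes\mathbb I)|\psi\rangle$ on outcome $k$. It is orthogonality-preserving if for each $k$ the postmeasurement vectors of distinct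 states are orthogonal. A state is eliminated by an outcome if its postmeasurement vector is zero while that of some other state is not. -/

import Mathlib

/-- The (not necessarily normalized) vectors of the multipartite system `⨂ i, ℂ^(d i)`, written in
the computational basis, whose elements are the tuples `x` with `x i ∈ {0, …, d i - 1}`. -/
abbrev MState {ι : Type} (d : ι → ℕ) : Type :=
  EuclideanSpace ℂ ((i : ι) → Fin (d i))

/-- A (pure, fully) product state: a nonzero vector of the form `⨂ i, v i`. -/
def IsProductState {ι : Type} [Fintype ι] {d : ι → ℕ} (ψ : MState d) : Prop :=
  ψ ≠ 0 ∧ ∃ v : (i : ι) → EuclideanSpace ℂ (Fin (d i)), ∀ x, ψ x = ∏ i, v i (x i)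

/-- An orthogonal product set: a finite set of mutually orthogonal product states. -/
def IsOPS {ι : Type} [Fintype ι] [DecidableEq ι] {d : ι → ℕ} (U : Finset (MState d)) : Prop :=
  (∀ ψ ∈ U, IsProductState ψ) ∧ ∀ ψ ∈ U, ∀ φ ∈ U, ψ ≠ φ → inner ℂ ψ φ = 0

/-- An unextendible product basis: an orthogonal product set which does not span the whole space
and whose complementary subspace contains no product state. -/
def IsUPB {ι : Type} [Fintype ι] [DecidableEq ι] {d : ι → ℕ} (U : Finset (MState d)) : Prop :=
  IsOPS U ∧
  Submodule.span ℂ (U : Set (MState d)) ≠ ⊤ ∧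
  ∀ φ ∈ (Submodule.span ℂ (U : Set (MState d)))ᗮ, ¬ IsProductState φ

/-- Operators on the joint system `⨂ i ∈ P, ℂ^(d i)` of the parties in `P`. -/
abbrev GroupOp {ι : Type} (d : ι → ℕ) (P : Finset ι) : Type :=
  Matrix ((i : {i // i ∈ P}) → Fin (d i)) ((i : {i // i ∈ P}) → Fin (d i)) ℂ

/-- The operator `M ⊗ 𝟙` applied to `ψ`, where `M` acts on the parties in `P` and the identity on
all other parties. -/
noncomputable def applyOn {ι : Type} [Fintype ι] [DecidableEq ι] {d : ι → ℕ} {P : Finset ι}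
    (M : GroupOp d P) (ψ : MState d) : MState d :=
  WithLp.toLp 2 fun x =>
    ∑ y : (i : {i // i ∈ P}) → Fin (d i),
      M (fun i => x i) y * ψ (fun i => if h : i ∈ P then y ⟨i, h⟩ else x i)

/-- A measurement by the parties in `P` acting together: finitely many operators `M k` whose
POVM elements `(M k)ᴴ * M k` add up to the identity. -/
def IsMeasurement {ι : Type} [DecidableEq ι] {d : ι → ℕ} {P : Finset ι} {m : ℕ}
    (M : Fin m → GroupOp d P) : Prop :=
  ∑ k, (M k).conjTranspose * M k = 1

/-- The measurement `M` keeps the states `ψ i` mutually orthogonal, whatever the outcome. -/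
def PreservesOrthogonality {κ ι : Type} [Fintype ι] [DecidableEq ι] {d : ι → ℕ}
    {P : Finset ι} {m : ℕ} (M : Fin m → GroupOp d P) (ψ : κ → MState d) : Prop :=
  ∀ k i j, i ≠ j → inner ℂ (applyOn (M k) (ψ i)) (applyOn (M k) (ψ j)) = 0

/-- One or more (but not all) of the states `ψ i` can be eliminated by finitely many successive
orthogonality-preserving local measurements, each made by one of the two sides of the bipartition
`T | Tᶜ`, where the later measurements may depend on the earlier outcomes. An outcome whose
operator annihilates all the states never occurs and is disregarded. -/
inductive CanEliminate {κ ι : Type} [Fintype ι] [DecidableEq ι] {d : ι → ℕ} (T : Finset ι) :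
    (κ → MState d) → Prop
  | now {ψ : κ → MState d} (P : Finset ι) (hP : P = T ∨ P = Tᶜ) {m : ℕ}
      (M : Fin m → GroupOp d P) (hM : IsMeasurement M) (hO : PreservesOrthogonality M ψ)
      (k : Fin m) (i j : κ) (hi : applyOn (M k) (ψ i) = 0) (hj : applyOn (M k) (ψ j) ≠ 0) :
      CanEliminate T ψ
  | later {ψ : κ → MState d} (P : Finset ι) (hP : P = T ∨ P = Tᶜ) {m : ℕ}
      (M : Fin m → GroupOp d P) (hM : IsMeasurement M) (hO : PreservesOrthogonality M ψ)
      (k : Fin m) (j : κ) (hj : applyOn (M k) (ψ j) ≠ 0)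
      (h : CanEliminate T fun i => applyOn (M k) (ψ i)) :
      CanEliminate T ψ

/-- `U` is locally irreducible in the bipartition `T | Tᶜ`: no state of `U` can be eliminated by
orthogonality-preserving local measurements of the two sides. -/
def IsLocallyIrreducible {ι : Type} [Fintype ι] [DecidableEq ι] {d : ι → ℕ} (T : Finset ι)
    (U : Finset (MState d)) : Prop :=
  ¬ CanEliminate T fun ψ : {ψ // ψ ∈ U} => ψ.1

/-- `U` is strongly nonlocal: locally irreducible in every bipartition of the set of parties into
two nonempty groups. -/
def IsStronglyNonlocal {ι : Type} [Fintype ι] [DecidableEq ι] {d : ι → ℕ}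
    (U : Finset (MState d)) : Prop :=
  ∀ T : Finset ι, T.Nonempty → Tᶜ.Nonempty → IsLocallyIrreducible T U

/-! The grid of basis tuples is cut into `s + 1` nested shells and a nonempty central box, and each
shell into 16 boxes indexed by the corners `c` of a 4-cube. Such a box sits at the end `c j` in
direction `j` and reaches into the interior there iff `c j ≠ c (j + 1)`, cyclically, the rule being
reversed for the last `j`. By this twist an odd number of directions is extended, never all four.
The basis consists of the nonuniform product Fourier states of all boxes and one all-ones stopper.
There are `16 * (s + 1) + 1` boxes and each loses one state, which gives the count.

Unextendibility: a vector orthogonal to the nonuniform states is constant on every box. If it is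
also a product, the boxes compare its factors along lines. Shell by shell, either the support
retreats into the next inner box or every factor has nonzero sum (`support_or_sum_ne_zero`). In the
central box all factors are constant, so the sums are nonzero in any case and the stopper is not
orthogonal to the vector.

Strong nonlocality: an operator `M` of one side misses some party, and the symmetry of the pattern
allows this party to be called A. Then `Mᴴ * M`, extended by the identity, is a Hermitian kernel `E`
on the other three parties. Blocks that are long in A overlap there in nonorthogonal nonuniform
functions, so `E` vanishes between the projections of different ones; these partition everything but
the interior. Blocks that are short in A lack the uniform function and give relations up to
functions of one variable. The stopper makes column sums constant on every projection. Together
these force `E` to be a multiple of the identity (`kernel_scalar`); only the outer shell and the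
stopper are needed. Hence every admissible operator is a multiple of an isometry. It rescales all
inner products by one factor, so the same rigidity holds in later rounds and no state is ever
eliminated. -/

open Finset ComplexConjugate Matrix

/-! ### Fourier systems and kernels that are diagonal in them -/

/-- A family of functions indexed by `K` that behaves like the characters of a finite abelian group
`G` transported along `idx` to the finite set `R`, extended by zero outside `R`. -/
structure IsFourierSystem {Y G K : Type*} [Fintype Y] [DecidableEq Y] [AddCommGroup G] [Fintype K]
    [DecidableEq K] [Zero K] (R : Finset Y) (idx : Y → G) (φ : K → Y → ℂ) : Prop where
  idx_inj : ∀ x ∈ R, ∀ y ∈ R, idx x = idx y → x = y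
  idx_surj : ∀ g, ∃ x ∈ R, idx x = g
  supp : ∀ k, ∀ x ∉ R, φ k x = 0
  zero : ∀ x ∈ R, φ 0 x = 1
  unimodular : ∀ k, ∀ x ∈ R, φ k x * conj (φ k x) = 1
  trans : ∃ Φ : K → G → ℂ, ∀ k, ∀ x ∈ R, ∀ y ∈ R, φ k x * conj (φ k y) = Φ k (idx x - idx y)
  complete : ∀ x ∈ R, ∀ y ∈ R, ∑ k, φ k x * conj (φ k y) = if x = y then (#R : ℂ) else 0
  orth : ∀ k l, ∑ x, conj (φ k x) * φ l x = if k = l then (#R : ℂ) else 0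

/-- The sesquilinear form with kernel `F`. -/
noncomputable def sesq {Y Y' : Type*} [Fintype Y] [Fintype Y'] (F : Y → Y' → ℂ) (u : Y → ℂ)
    (w : Y' → ℂ) : ℂ :=
  ∑ x, ∑ y, conj (u x) * F x y * w y

theorem sesq_eq {Y Y' : Type*} [Fintype Y] [Fintype Y'] (F : Y → Y' → ℂ) (u : Y → ℂ)
    (w : Y' → ℂ) :
    sesq F u w = ∑ x, conj (u x) * ∑ y, F x y * w y := by
  simp_rw [sesq, Finset.mul_sum, mul_assoc]

namespace IsFourierSystem

section

variable {Y G K : Type*} [Fintype Y] [DecidableEq Y] [AddCommGroup G] [Fintype K]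
  [DecidableEq K] [Zero K] {R : Finset Y} {idx : Y → G} {φ : K → Y → ℂ}

theorem nonempty (h : IsFourierSystem R idx φ) : R.Nonempty :=
  let ⟨x, hx, _⟩ := h.idx_surj 0
  ⟨x, hx⟩

theorem card_ne_zero (h : IsFourierSystem R idx φ) : (#R : ℂ) ≠ 0 := by
  exact_mod_cast (Finset.card_pos.2 h.nonempty).ne'

theorem ne_zero (h : IsFourierSystem R idx φ) (k : K) {x : Y} (hx : x ∈ R) : φ k x ≠ 0 := by
  intro h0
  have := h.unimodular k x hx
  simp [h0] at this

theorem reconstruct (h : IsFourierSystem R idx φ) (g : Y → ℂ) {x : Y} (hx : x ∈ R) :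
    ∑ k, φ k x * ∑ y, conj (φ k y) * g y = #R * g x := by
  have h1 : ∀ y, ∑ k, φ k x * (conj (φ k y) * g y) = if x = y then (#R : ℂ) * g y else 0 := by
    intro y
    by_cases hy : y ∈ R
    · simp_rw [← mul_assoc, ← Finset.sum_mul, h.complete x hx y hy, ite_mul, zero_mul]
    · have : x ≠ y := fun e => hy (e ▸ hx)
      simp [h.supp _ y hy, this]
  simp_rw [Finset.mul_sum]
  rw [Finset.sum_comm]
  simp [h1]

theorem eq_zero (h : IsFourierSystem R idx φ) {g : Y → ℂ}
    (hg : ∀ k, ∑ y, conj (φ k y) * g y = 0) {x : Y} (hx : x ∈ R) : g x = 0 := by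
  have := h.reconstruct g hx
  simpa [hg, h.card_ne_zero] using this.symm

/-- In the Fourier inversion of `g` only the zero frequency survives, and that function is uniform
on `R`. -/
theorem const (h : IsFourierSystem R idx φ) {g : Y → ℂ}
    (hg : ∀ k, k ≠ 0 → ∑ y, conj (φ k y) * g y = 0) {x y : Y} (hx : x ∈ R) (hy : y ∈ R) :
    g x = g y := by
  have key : ∀ z ∈ R, #R * g z = ∑ y, conj (φ 0 y) * g y := by
    intro z hz
    rw [← h.reconstruct g hz, Finset.sum_eq_single 0]
    · simp [h.zero z hz]
    · intro k _ hk
      simp [hg k hk]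
    · simp
  exact mul_left_cancel₀ h.card_ne_zero ((key x hx).trans (key y hy).symm)

theorem eq_zero' (h : IsFourierSystem R idx φ) {g : Y → ℂ}
    (hg : ∀ k, ∑ y, g y * φ k y = 0) {x : Y} (hx : x ∈ R) : g x = 0 := by
  have := h.eq_zero (g := fun y => conj (g y)) (fun k => by
    have := congrArg conj (hg k)
    simpa [mul_comm] using this) hx
  simpa using this

theorem const' (h : IsFourierSystem R idx φ) {g : Y → ℂ}
    (hg : ∀ k, k ≠ 0 → ∑ y, g y * φ k y = 0) {x y : Y} (hx : x ∈ R) (hy : y ∈ R) :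
    g x = g y := by
  have := h.const (g := fun y => conj (g y)) (fun k hk => by
    have := congrArg conj (hg k hk)
    simpa [mul_comm] using this) hx hy
  exact (starRingEnd ℂ).injective this

theorem sum_eq_zero (h : IsFourierSystem R idx φ) {k : K} (hk : k ≠ 0) : ∑ x, φ k x = 0 := by
  have := h.orth 0 k
  rw [if_neg hk.symm] at this
  rw [← this]
  refine Finset.sum_congr rfl fun x _ => ?_
  by_cases hx : x ∈ R
  · simp [h.zero x hx]
  · simp [h.supp _ x hx]

theorem sum_zero_freq (h : IsFourierSystem R idx φ) : ∑ x, φ 0 x = #R := by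
  have := h.orth 0 0
  rw [if_pos rfl] at this
  rw [← this]
  refine Finset.sum_congr rfl fun x _ => ?_
  by_cases hx : x ∈ R
  · simp [h.zero x hx]
  · simp [h.supp _ x hx]

theorem exists_ne_zero_freq (h : IsFourierSystem R idx φ) {x y : Y} (hx : x ∈ R) (hy : y ∈ R)
    (hxy : x ≠ y) : ∃ k : K, k ≠ 0 := by
  by_contra! hk
  have := h.const (g := fun z => if z = x then 1 else 0) (fun k hk' => absurd (hk k) hk') hx hy
  simp [hxy.symm] at this

theorem expand (h : IsFourierSystem R idx φ) (F : Y → Y → ℂ) {x y : Y} (hx : x ∈ R) (hy : y ∈ R) :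
    ∑ k, ∑ l, φ k x * conj (φ l y) * sesq F (φ k) (φ l) = #R * #R * F x y := by
  have h1 : ∀ k, ∑ l, conj (φ l y) * sesq F (φ k) (φ l) = #R * ∑ z, conj (φ k z) * F z y := by
    intro k
    have := congrArg conj (h.reconstruct (fun w => conj (∑ z, conj (φ k z) * F z w)) hy)
    simp only [map_sum, map_mul, Complex.conj_conj, Complex.conj_natCast] at this
    rw [← this]
    refine Finset.sum_congr rfl fun l _ => ?_
    congr 1
    unfold sesq
    rw [Finset.sum_comm]
    refine Finset.sum_congr rfl fun w _ => ?_
    rw [Finset.mul_sum]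
    exact Finset.sum_congr rfl fun z _ => by ring
  calc _ = ∑ k, φ k x * ∑ l, conj (φ l y) * sesq F (φ k) (φ l) := by
        simp_rw [Finset.mul_sum, mul_assoc]
    _ = #R * ∑ k, φ k x * ∑ z, conj (φ k z) * F z y := by
        simp_rw [h1]
        rw [Finset.mul_sum]
        exact Finset.sum_congr rfl fun k _ => by ring
    _ = _ := by rw [h.reconstruct (fun z => F z y) hx]; ring

/-- A kernel that is diagonal in a Fourier system is invariant under translations. -/
theorem exists_kernel (h : IsFourierSystem R idx φ) {F : Y → Y → ℂ}
    (hF : ∀ k l, k ≠ l → sesq F (φ k) (φ l) = 0) :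
    ∃ K' : G → ℂ, ∀ x ∈ R, ∀ y ∈ R, F x y = K' (idx x - idx y) := by
  obtain ⟨Φ, hΦ⟩ := h.trans
  refine ⟨fun g => (∑ k, Φ k g * sesq F (φ k) (φ k)) / (#R * #R), fun x hx y hy => ?_⟩
  have h0 := h.card_ne_zero
  rw [eq_div_iff (mul_ne_zero h0 h0), mul_comm, ← h.expand F hx hy]
  refine Finset.sum_congr rfl fun k _ => ?_
  rw [Finset.sum_eq_single k, hΦ k x hx y hy]
  · intro l _ hl
    rw [hF k l hl.symm, mul_zero]
  · simp

/-- A kernel that is diagonal in a Fourier system and has a column like that of a multiple of the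
identity is a multiple of the identity. -/
theorem kernel_scalar_of_column (h : IsFourierSystem R idx φ) {F : Y → Y → ℂ}
    (hF : ∀ k l, k ≠ l → sesq F (φ k) (φ l) = 0) {x : Y} (hx : x ∈ R) {t : ℂ}
    (hcol : ∀ y ∈ R, F y x = if y = x then t else 0) {y z : Y} (hy : y ∈ R) (hz : z ∈ R) :
    F y z = if y = z then t else 0 := by
  obtain ⟨K', hK⟩ := h.exists_kernel hF
  -- The point `w` differs from `x` as `y` differs from `z`, so translation invariance reads `F y z`
  -- off the given column.
  obtain ⟨w, hw, hw'⟩ := h.idx_surj (idx y - idx z + idx x)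
  have h1 := hK w hw x hx
  rw [hw', add_sub_cancel_right, ← hK y hy z hz, hcol w hw] at h1
  rw [← h1]
  refine if_congr ⟨fun e => ?_, fun e => ?_⟩ rfl rfl
  · rw [e, right_eq_add, sub_eq_zero] at hw'
    exact h.idx_inj _ hy _ hz hw'
  · rw [e, sub_self, zero_add] at hw'
    exact h.idx_inj _ hw _ hx hw'

/-- A kernel that is diagonal in a Fourier system, up to the uniform function, is invariant under
translations up to a sum of functions of one variable. -/
theorem exists_kernel_add (h : IsFourierSystem R idx φ) {F : Y → Y → ℂ}
    (hF : ∀ k l, k ≠ 0 → l ≠ 0 → k ≠ l → sesq F (φ k) (φ l) = 0) :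
    ∃ (K' : G → ℂ) (v u : Y → ℂ), ∀ x ∈ R, ∀ y ∈ R, F x y = K' (idx x - idx y) + v x + u y := by
  obtain ⟨Φ, hΦ⟩ := h.trans
  have h0 := h.card_ne_zero
  set S := fun k l => sesq F (φ k) (φ l) with hS
  refine ⟨fun g => (∑ k, Φ k g * S k k) / (#R * #R),
    fun x => (∑ k, if k = 0 then 0 else φ k x * S k 0) / (#R * #R),
    fun y => (∑ l, if l = 0 then 0 else conj (φ l y) * S 0 l) / (#R * #R), fun x hx y hy => ?_⟩
  rw [← add_div, ← add_div, eq_div_iff (mul_ne_zero h0 h0), mul_comm, ← h.expand F hx hy]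
  -- The surviving terms are the diagonal ones, which are translation invariant, and those with `l =
  -- 0` or `k = 0`, which depend on one variable because `φ 0` is uniform.
  have h1 : ∀ k l, φ k x * conj (φ l y) * S k l = (if l = k then Φ k (idx x - idx y) * S k k else 0)
      + (if l = 0 then (if k = 0 then 0 else φ k x * S k 0) else 0)
      + (if k = 0 then (if l = 0 then 0 else conj (φ l y) * S 0 l) else 0) := by
    intro k l
    by_cases hkl : l = k
    · subst hkl
      simp only [if_true]
      rw [← hΦ l x hx y hy]
      split_ifs <;> simp
    · by_cases hk : k = 0
      · subst hk
        simp [hkl, h.zero x hx]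
      · by_cases hl : l = 0
        · subst hl
          simp [hk, Ne.symm hk, h.zero y hy]
        · simp [hk, hl, hkl, hS, hF k l hk hl (Ne.symm hkl)]
  change ∑ k, ∑ l, φ k x * conj (φ l y) * S k l = _
  simp_rw [h1, Finset.sum_add_distrib]
  congr 1
  · congr 1
    · simp
    · simp
  · rw [Finset.sum_comm]
    simp

end

section

variable {Y G K Y' G' K' : Type*} [Fintype Y] [DecidableEq Y] [AddCommGroup G] [Fintype K]
  [DecidableEq K] [Zero K] {R : Finset Y} {idx : Y → G} {φ : K → Y → ℂ}
  [Fintype Y'] [DecidableEq Y'] [AddCommGroup G'] [Fintype K']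
  [DecidableEq K'] [Zero K'] {R' : Finset Y'} {idx' : Y' → G'} {φ' : K' → Y' → ℂ}

/-- This and the next two lemmas measure the cost of a missing uniform function: with all
frequencies available the kernel vanishes, without zero on the left it is constant on the left, and
without zero on either side only its mixed differences vanish. -/
theorem kernel_eq_zero (h : IsFourierSystem R idx φ) (h' : IsFourierSystem R' idx' φ')
    {F : Y → Y' → ℂ} (hF : ∀ k l, sesq F (φ k) (φ' l) = 0) {x : Y} {y : Y'} (hx : x ∈ R)
    (hy : y ∈ R') : F x y = 0 :=
  h'.eq_zero' (g := F x) (fun l => h.eq_zero (g := fun x => ∑ y, F x y * φ' l y)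
    (fun k => by rw [← sesq_eq, hF]) hx) hy

theorem kernel_const_left (h : IsFourierSystem R idx φ) (h' : IsFourierSystem R' idx' φ')
    {F : Y → Y' → ℂ} (hF : ∀ k l, k ≠ 0 → sesq F (φ k) (φ' l) = 0) {x₁ x₂ : Y} {y : Y'}
    (hx₁ : x₁ ∈ R) (hx₂ : x₂ ∈ R) (hy : y ∈ R') : F x₁ y = F x₂ y := by
  rw [← sub_eq_zero]
  refine h'.eq_zero' (g := fun y => F x₁ y - F x₂ y) (fun l => ?_) hy
  simp_rw [sub_mul, Finset.sum_sub_distrib, sub_eq_zero]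
  exact h.const (g := fun x => ∑ y, F x y * φ' l y) (fun k hk => by rw [← sesq_eq, hF k l hk])
    hx₁ hx₂

theorem kernel_second_difference (h : IsFourierSystem R idx φ) (h' : IsFourierSystem R' idx' φ')
    {F : Y → Y' → ℂ} (hF : ∀ k l, k ≠ 0 → l ≠ 0 → sesq F (φ k) (φ' l) = 0) {x₁ x₂ : Y}
    {y₁ y₂ : Y'} (hx₁ : x₁ ∈ R) (hx₂ : x₂ ∈ R) (hy₁ : y₁ ∈ R') (hy₂ : y₂ ∈ R') :
    F x₁ y₁ - F x₂ y₁ = F x₁ y₂ - F x₂ y₂ := by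
  refine h'.const' (g := fun y => F x₁ y - F x₂ y) (fun l hl => ?_) hy₁ hy₂
  simp_rw [sub_mul, Finset.sum_sub_distrib, sub_eq_zero]
  exact h.const (g := fun x => ∑ y, F x y * φ' l y) (fun k hk => by rw [← sesq_eq, hF k l hk hl])
    hx₁ hx₂

/-- Two Fourier systems on intersecting sets with more than one element contain two nonuniform
functions that are not orthogonal to each other. -/
theorem exists_inner_ne_zero {R' : Finset Y} {idx' : Y → G'} {φ' : K' → Y → ℂ}
    (h : IsFourierSystem R idx φ) (h' : IsFourierSystem R' idx' φ') {x y z : Y} (hx : x ∈ R)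
    (hx' : x ∈ R') (hy : y ∈ R) (hxy : x ≠ y) (hz : z ∈ R') (hxz : x ≠ z) :
    ∃ k l, k ≠ 0 ∧ l ≠ 0 ∧ ∑ a, conj (φ k a) * φ' l a ≠ 0 := by
  by_contra! H
  -- Otherwise the identity kernel would have vanishing mixed differences, which fails at the common
  -- point `x`.
  have := h.kernel_second_difference h' (F := fun a b => if a = b then 1 else 0)
    (fun k l hk hl => Eq.trans (by simp [sesq]) (H k l hk hl)) hx hy hx' hz
  simp only [if_true, hxz, hxy.symm, if_false] at this
  split_ifs at this <;> norm_num at this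

theorem prod (h : IsFourierSystem R idx φ) (h' : IsFourierSystem R' idx' φ') :
    IsFourierSystem (R ×ˢ R') (fun p : Y × Y' => (idx p.1, idx' p.2))
      (fun (k : K × K') p => φ k.1 p.1 * φ' k.2 p.2) where
  idx_inj := by
    rintro ⟨x, x'⟩ hx ⟨y, y'⟩ hy e
    rw [Finset.mem_product] at hx hy
    rw [Prod.mk.injEq] at e ⊢
    exact ⟨h.idx_inj _ hx.1 _ hy.1 e.1, h'.idx_inj _ hx.2 _ hy.2 e.2⟩
  idx_surj := by
    rintro ⟨g, g'⟩
    obtain ⟨x, hx, rfl⟩ := h.idx_surj g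
    obtain ⟨x', hx', rfl⟩ := h'.idx_surj g'
    exact ⟨(x, x'), Finset.mk_mem_product hx hx', rfl⟩
  supp := by
    rintro k ⟨x, x'⟩ hx
    rw [Finset.mem_product, not_and_or] at hx
    rcases hx with hx | hx
    · simp [h.supp _ _ hx]
    · simp [h'.supp _ _ hx]
  zero := by
    rintro ⟨x, x'⟩ hx
    rw [Finset.mem_product] at hx
    simp [h.zero _ hx.1, h'.zero _ hx.2]
  unimodular := by
    rintro k ⟨x, x'⟩ hx
    rw [Finset.mem_product] at hx
    simp only [map_mul]
    rw [mul_mul_mul_comm, h.unimodular _ _ hx.1, h'.unimodular _ _ hx.2, one_mul]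
  trans := by
    obtain ⟨Φ, hΦ⟩ := h.trans
    obtain ⟨Φ', hΦ'⟩ := h'.trans
    refine ⟨fun k g => Φ k.1 g.1 * Φ' k.2 g.2, ?_⟩
    rintro k ⟨x, x'⟩ hx ⟨y, y'⟩ hy
    rw [Finset.mem_product] at hx hy
    simp only [map_mul]
    rw [mul_mul_mul_comm, hΦ _ _ hx.1 _ hy.1, hΦ' _ _ hx.2 _ hy.2]
    rfl
  complete := by
    rintro ⟨x, x'⟩ hx ⟨y, y'⟩ hy
    rw [Finset.mem_product] at hx hy
    have := congrArg₂ (· * ·) (h.complete _ hx.1 _ hy.1) (h'.complete _ hx.2 _ hy.2)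
    simp only [Finset.sum_mul_sum, ← Fintype.sum_prod_type'] at this
    simp only [map_mul, mul_mul_mul_comm _ _ (conj _)]
    rw [this]
    simp only [Prod.mk.injEq, Finset.card_product, Nat.cast_mul]
    split_ifs <;> simp_all
  orth := by
    rintro ⟨k, k'⟩ ⟨l, l'⟩
    have := congrArg₂ (· * ·) (h.orth k l) (h'.orth k' l')
    simp only [Finset.sum_mul_sum, ← Fintype.sum_prod_type'] at this
    simp only [map_mul, mul_mul_mul_comm (conj _) (conj _)]
    rw [this]
    simp only [Prod.mk.injEq, Finset.card_product, Nat.cast_mul]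
    split_ifs <;> simp_all

end

theorem pi {ι : Type*} [Fintype ι] [DecidableEq ι] {Y G K : ι → Type*} [∀ i, Fintype (Y i)]
    [∀ i, DecidableEq (Y i)] [∀ i, AddCommGroup (G i)] [∀ i, Fintype (K i)]
    [∀ i, DecidableEq (K i)] [∀ i, Zero (K i)] {R : ∀ i, Finset (Y i)} {idx : ∀ i, Y i → G i}
    {φ : ∀ i, K i → Y i → ℂ} (h : ∀ i, IsFourierSystem (R i) (idx i) (φ i)) :
    IsFourierSystem (Fintype.piFinset R) (fun (x : ∀ i, Y i) i => idx i (x i))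
      (fun (k : ∀ i, K i) x => ∏ i, φ i (k i) (x i)) where
  idx_inj := by
    intro x hx y hy e
    rw [Fintype.mem_piFinset] at hx hy
    exact funext fun i => (h i).idx_inj _ (hx i) _ (hy i) (congrFun e i)
  idx_surj := by
    intro g
    choose x hx hg using fun i => (h i).idx_surj (g i)
    exact ⟨x, Fintype.mem_piFinset.2 hx, funext hg⟩
  supp := by
    intro k x hx
    rw [Fintype.mem_piFinset, not_forall] at hx
    obtain ⟨i, hi⟩ := hx
    exact Finset.prod_eq_zero (Finset.mem_univ i) ((h i).supp _ _ hi)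
  zero := by
    intro x hx
    rw [Fintype.mem_piFinset] at hx
    exact Finset.prod_eq_one fun i _ => (h i).zero _ (hx i)
  unimodular := by
    intro k x hx
    rw [Fintype.mem_piFinset] at hx
    rw [map_prod, ← Finset.prod_mul_distrib]
    exact Finset.prod_eq_one fun i _ => (h i).unimodular _ _ (hx i)
  trans := by
    choose Φ hΦ using fun i => (h i).trans
    refine ⟨fun k g => ∏ i, Φ i (k i) (g i), fun k x hx y hy => ?_⟩
    rw [Fintype.mem_piFinset] at hx hy
    rw [map_prod, ← Finset.prod_mul_distrib]
    exact Finset.prod_congr rfl fun i _ => hΦ i _ _ (hx i) _ (hy i)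
  complete := by
    intro x hx y hy
    rw [Fintype.mem_piFinset] at hx hy
    simp_rw [map_prod, ← Finset.prod_mul_distrib]
    rw [← Fintype.prod_sum (fun i (k : K i) => φ i k (x i) * conj (φ i k (y i)))]
    rw [Finset.prod_congr rfl fun i _ => (h i).complete _ (hx i) _ (hy i)]
    rw [Fintype.card_piFinset, Nat.cast_prod]
    split_ifs with e
    · simp [e]
    · obtain ⟨i, hi⟩ := Function.ne_iff.1 e
      exact Finset.prod_eq_zero (Finset.mem_univ i) (if_neg hi)
  orth := by
    intro k l
    simp_rw [map_prod, ← Finset.prod_mul_distrib]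
    rw [← Fintype.prod_sum (fun i (x : Y i) => conj (φ i (k i) x) * φ i (l i) x)]
    rw [Finset.prod_congr rfl fun i _ => (h i).orth (k i) (l i)]
    rw [Fintype.card_piFinset, Nat.cast_prod]
    split_ifs with e
    · simp [e]
    · obtain ⟨i, hi⟩ := Function.ne_iff.1 e
      exact Finset.prod_eq_zero (Finset.mem_univ i) (if_neg hi)

end IsFourierSystem

/-! ### The discrete Fourier basis of a finite set -/

/-- An enumeration of a finite set by residues. -/
noncomputable def residueIndex {X : Type*} [DecidableEq X] (S : Finset X) (x : X) :
    ZMod (#S - 1 + 1) :=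
  if h : x ∈ S then ((S.equivFin ⟨x, h⟩ : ℕ) : ZMod (#S - 1 + 1)) else 0

/-- The discrete Fourier basis of the functions on a finite set `S`, extended by zero. -/
noncomputable def fourierVec {X : Type*} [DecidableEq X] (S : Finset X) (k : ZMod (#S - 1 + 1))
    (x : X) : ℂ :=
  if x ∈ S then ZMod.stdAddChar (k * residueIndex S x) else 0

theorem isFourierSystem_fourierVec {X : Type*} [Fintype X] [DecidableEq X] {S : Finset X}
    (hS : S.Nonempty) : IsFourierSystem S (residueIndex S) (fourierVec S) := by
  -- The modulus is a visible successor, so `ZMod` of it is finite even before `S` is known to be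
  -- nonempty.
  have hc : #S - 1 + 1 = #S := Nat.sub_add_cancel (Finset.card_pos.2 hS)
  have hinj : ∀ x ∈ S, ∀ y ∈ S, residueIndex S x = residueIndex S y → x = y := by
    intro x hx y hy e
    simp only [residueIndex, dif_pos hx, dif_pos hy] at e
    rw [ZMod.natCast_eq_natCast_iff'] at e
    rw [Nat.mod_eq_of_lt (by rw [hc]; exact Fin.is_lt _),
      Nat.mod_eq_of_lt (by rw [hc]; exact Fin.is_lt _)] at e
    have := S.equivFin.injective (Fin.ext e)
    simpa using this
  have himg : S.image (residueIndex S) = univ := by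
    apply Finset.eq_univ_of_card
    rw [Finset.card_image_of_injOn (fun x hx y hy => hinj x hx y hy), ZMod.card, hc]
  have hconj : ∀ a : ZMod (#S - 1 + 1), conj (ZMod.stdAddChar a) = (ZMod.stdAddChar (-a) : ℂ) := by
    intro a
    rw [AddChar.map_neg_eq_conj]
  have hsum : ∀ b : ZMod (#S - 1 + 1), ∑ k, (ZMod.stdAddChar (k * b) : ℂ)
      = if b = 0 then (#S : ℂ) else 0 := by
    intro b
    rw [AddChar.sum_mulShift b (ZMod.isPrimitive_stdAddChar _), ZMod.card]
    simp [hc]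
  refine ⟨hinj, ?_, ?_, ?_, ?_, ?_, ?_, ?_⟩
  · intro g
    have := Finset.mem_univ g
    rw [← himg, Finset.mem_image] at this
    exact this
  · intro k x hx
    simp [fourierVec, hx]
  · intro x hx
    simp [fourierVec, hx]
  · intro k x hx
    simp only [fourierVec, if_pos hx]
    rw [hconj, ← AddChar.map_add_eq_mul]
    simp
  · refine ⟨fun k g => ZMod.stdAddChar (k * g), fun k x hx y hy => ?_⟩
    simp only [fourierVec, if_pos hx, if_pos hy]
    rw [hconj, ← AddChar.map_add_eq_mul]
    congr 1
    ring
  · intro x hx y hy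
    simp only [fourierVec, if_pos hx, if_pos hy]
    simp_rw [hconj, ← AddChar.map_add_eq_mul, ← mul_neg, ← mul_add]
    rw [hsum, ← sub_eq_add_neg]
    simp only [sub_eq_zero]
    exact if_congr ⟨hinj x hx y hy, fun e => e ▸ rfl⟩ rfl rfl
  · intro k l
    have h1 : ∑ x, conj (fourierVec S k x) * fourierVec S l x
        = ∑ x ∈ S, ZMod.stdAddChar (residueIndex S x * (l - k)) := by
      rw [← Finset.sum_subset (Finset.subset_univ S)]
      · refine Finset.sum_congr rfl fun x hx => ?_
        simp only [fourierVec, if_pos hx]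
        rw [hconj, ← AddChar.map_add_eq_mul]
        congr 1
        ring
      · intro x _ hx
        simp [fourierVec, hx]
    rw [h1, ← Finset.sum_image (f := fun g => (ZMod.stdAddChar (g * (l - k)) : ℂ))
      (fun x hx y hy => hinj x hx y hy), himg, hsum]
    simp only [sub_eq_zero]
    exact if_congr eq_comm rfl rfl

/-! ### Kernels that are translation invariant up to functions of one variable -/

/-- The function `α - α 0` turns out to be additive, and a finite group has no nonzero homomorphism
to the torsion-free group `ℂ`. -/
theorem const_of_sub_eq_add {H : Type*} [AddCommGroup H] [Finite H] {k α β : H → ℂ}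
    (hk : ∀ h h', k (h - h') = α h + β h') : (∀ h, α h = α 0) ∧ ∀ h, β h = β 0 := by
  have h1 : ∀ g h, α (g + h) + β h = α g + β 0 := fun g h => by
    rw [← hk, ← hk, add_sub_cancel_right, sub_zero]
  have h2 : ∀ h, α h + β h = α 0 + β 0 := fun h => by simpa using h1 0 h
  have h3 : ∀ g h, α (g + h) - α 0 = (α g - α 0) + (α h - α 0) := fun g h => by
    linear_combination h1 g h - h2 h
  let f : H →+ ℂ := AddMonoidHom.mk' (fun h => α h - α 0) h3
  have h4 : ∀ h, α h = α 0 := by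
    intro h
    have h5 : Nat.card H • f h = 0 := by
      rw [← map_nsmul, card_nsmul_eq_zero', map_zero]
    rw [nsmul_eq_mul, mul_eq_zero] at h5
    rcases h5 with h5 | h5
    · exact absurd (by exact_mod_cast h5) (Nat.card_pos (α := H)).ne'
    · exact sub_eq_zero.1 h5
  exact ⟨h4, fun h => by linear_combination h2 h - h4 h⟩

/-- A kernel on `G₁ × G₂ × G₃`, translation invariant up to functions of one variable, that
vanishes between different ones of the pieces `{c = c₀}`, `{b = b₀} \ {c = c₀}`,
`{a = a₀} \ {b = b₀ ∨ c = c₀}` and the rest. -/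
theorem kernel_of_pieces {G₁ G₂ G₃ : Type*} [AddCommGroup G₁] [AddCommGroup G₂] [AddCommGroup G₃]
    [Finite G₁] [Finite G₂] [DecidableEq G₁] [DecidableEq G₂] [DecidableEq G₃]
    {F : G₁ × G₂ × G₃ → G₁ × G₂ × G₃ → ℂ} {K : G₁ × G₂ × G₃ → ℂ}
    {v u : G₁ × G₂ × G₃ → ℂ} (hF : ∀ x y, F x y = K (x - y) + v x + u y)
    {a₀ a₁ : G₁} {b₀ b₁ : G₂} {c₀ c₁ : G₃} (ha : a₁ ≠ a₀) (hb : b₁ ≠ b₀) (hc : c₁ ≠ c₀)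
    (h₃ : ∀ x y, x.2.2 = c₀ → y.2.2 ≠ c₀ → F x y = 0 ∧ F y x = 0)
    (h₂ : ∀ x y, x.2.2 ≠ c₀ → y.2.2 ≠ c₀ → x.2.1 = b₀ → y.2.1 ≠ b₀ → F x y = 0)
    (h₁ : ∀ x y, x.2.2 ≠ c₀ → y.2.2 ≠ c₀ → x.2.1 ≠ b₀ → y.2.1 ≠ b₀ → x.1 = a₀ → y.1 ≠ a₀ →
      F x y = 0) :
    (∀ x y, x ≠ y → ¬ (x.2.2 = c₀ ∧ y.2.2 = c₀) → F x y = 0) ∧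
    ∀ t : ℂ, (∀ x, x.1 ≠ a₀ → x.2.1 ≠ b₀ → x.2.2 ≠ c₀ → F x x = t) →
      (∀ x, x.2.2 ≠ c₀ → F x x = t) ∧
      ∃ r : ℂ, ∀ x y, x.2.2 = c₀ → y.2.2 = c₀ → F x y = (if x = y then t else 0) + r := by
  let i : G₁ × G₂ → G₃ → G₁ × G₂ × G₃ := fun h c => (h.1, h.2, c)
  have hi : ∀ h h' c c', i h c - i h' c' = i (h - h') (c - c') := fun _ _ _ _ => rfl
  have hx : ∀ x : G₁ × G₂ × G₃, x = i (x.1, x.2.1) x.2.2 := fun _ => rfl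
  -- Vanishing between the layers `c` and `c₀` expresses a function of `h - h'` as a sum of
  -- functions of `h` and of `h'`. Hence `v` and `u` depend only on the third coordinate.
  have e₁ : ∀ c, c ≠ c₀ → (∀ h, v (i h c) = v (i 0 c)) ∧ ∀ h, u (i h c₀) = u (i 0 c₀) := by
    intro c hc'
    have := const_of_sub_eq_add (k := fun g => - K (i g (c - c₀))) (α := fun h => v (i h c))
      (β := fun h => u (i h c₀)) (fun h h' => by
        have := (h₃ (i h' c₀) (i h c) rfl hc').2
        rw [hF, hi] at this
        linear_combination -this)
    exact this
  have e₂ : ∀ c, c ≠ c₀ → (∀ h, v (i h c₀) = v (i 0 c₀)) ∧ ∀ h, u (i h c) = u (i 0 c) := by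
    intro c hc'
    have := const_of_sub_eq_add (k := fun g => - K (i g (c₀ - c))) (α := fun h => v (i h c₀))
      (β := fun h => u (i h c)) (fun h h' => by
        have := (h₃ (i h c₀) (i h' c) rfl hc').1
        rw [hF, hi] at this
        linear_combination -this)
    exact this
  have hv : ∀ h c, v (i h c) = v (i 0 c) := fun h c => by
    by_cases hcc : c = c₀
    · exact hcc ▸ (e₂ c₁ hc).1 h
    · exact (e₁ c hcc).1 h
  have hu : ∀ h c, u (i h c) = u (i 0 c) := fun h c => by
    by_cases hcc : c = c₀
    · exact hcc ▸ (e₁ c₁ hc).2 h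
    · exact (e₂ c hcc).2 h
  have hK : ∀ g δ, δ ≠ 0 → K (i g δ) = K (i 0 δ) := by
    intro g δ hδ
    have key : ∀ g, K (i g δ) = - v (i 0 (c₀ + δ)) - u (i 0 c₀) := by
      intro g
      have := (h₃ (i 0 c₀) (i g (c₀ + δ)) rfl (by simpa [i] using hδ)).2
      rw [hF, hi, hv, add_sub_cancel_left, sub_zero] at this
      linear_combination this
    rw [key, key]
  -- Every nonzero difference within a layer is realized between two different pieces: by leaving `b
  -- = b₀` if the second component is nonzero, and otherwise by leaving `a = a₀` along `b = b₁`.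
  have hoff : ∀ c, c ≠ c₀ → ∀ g : G₁ × G₂, g ≠ 0 → K (i g 0) + v (i 0 c) + u (i 0 c) = 0 := by
    intro c hc' g hg
    by_cases hg2 : g.2 = 0
    · have hg1 : g.1 ≠ 0 := fun h => hg (Prod.ext h hg2)
      have := h₁ (i (a₀, b₁) c) (i (a₀ - g.1, b₁) c) hc' hc' hb hb rfl (by simpa [i] using hg1)
      rw [hF, hi, hv, hu] at this
      have e : ((a₀, b₁) - (a₀ - g.1, b₁) : G₁ × G₂) = g := by ext <;> simp [hg2]
      rwa [e, sub_self] at this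
    · have := h₂ (i (g.1, b₀) c) (i (0, b₀ - g.2) c) hc' hc' rfl (by simpa [i] using hg2)
      rw [hF, hi, hv, hu] at this
      have e : ((g.1, b₀) - (0, b₀ - g.2) : G₁ × G₂) = g := by ext <;> simp
      rwa [e, sub_self] at this
  refine ⟨fun x y hxy hn => ?_, fun t ht => ⟨fun x hxc => ?_, ?_⟩⟩
  · by_cases hcx : x.2.2 = c₀
    · exact (h₃ x y hcx fun h => hn ⟨hcx, h⟩).1
    by_cases hcy : y.2.2 = c₀
    · exact (h₃ y x hcy hcx).2
    by_cases hcc : x.2.2 = y.2.2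
    · rw [hx x, hx y, hF, hi, hv, hu, hcc, sub_self]
      refine hoff _ hcy _ fun h => hxy ?_
      rw [hx x, hx y, hcc, sub_eq_zero.1 h]
    -- Between different layers the kernel depends only on the layers, so one pair of points in
    -- different pieces settles all pairs.
    · have := h₂ (i (a₁, b₀) x.2.2) (i (a₁, b₁) y.2.2) hcx hcy rfl hb
      rw [hF, hi, hv, hu, hK _ _ (sub_ne_zero.2 hcc)] at this
      rw [hx x, hx y, hF, hi, hv, hu, hK _ _ (sub_ne_zero.2 hcc)]
      exact this
  · have := ht (i (a₁, b₁) x.2.2) ha hb hxc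
    rw [hF, hv, hu, sub_self] at this
    rw [hx x, hF, hv, hu, sub_self]
    exact this
  · have h0 := ht (i (a₁, b₁) c₁) ha hb hc
    rw [hF, hv, hu, sub_self] at h0
    -- Inside the layer `c₀` the values of `v` and `u` are unconstrained; they contribute the
    -- constant `r`, which only column sums can remove.
    refine ⟨K 0 - t + v (i 0 c₀) + u (i 0 c₀), fun x y hcx hcy => ?_⟩
    rw [hx x, hx y, hF, hv, hu, hcx, hcy, hi, sub_self]
    by_cases hxy : (x.1, x.2.1) = (y.1, y.2.1)
    · rw [hxy, sub_self, if_pos rfl]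
      change K 0 + _ + _ = _
      ring
    · rw [if_neg]
      · have := hoff c₁ hc _ (sub_ne_zero.2 hxy)
        linear_combination this - h0
      · intro h
        rw [Prod.mk.injEq, Prod.mk.injEq] at h
        exact hxy (Prod.ext h.1 h.2.1)

/-- The transport of `kernel_of_pieces` to a box along Fourier systems. -/
theorem IsFourierSystem.kernel_of_pieces {Y₁ G₁ K₁ Y₂ G₂ K₂ Y₃ G₃ K₃ : Type*}
    [Fintype Y₁] [DecidableEq Y₁] [AddCommGroup G₁] [Fintype K₁] [DecidableEq K₁] [Zero K₁]
    [Fintype Y₂] [DecidableEq Y₂] [AddCommGroup G₂] [Fintype K₂] [DecidableEq K₂] [Zero K₂]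
    [Fintype Y₃] [DecidableEq Y₃] [AddCommGroup G₃] [Fintype K₃] [DecidableEq K₃] [Zero K₃]
    {R₁ : Finset Y₁} {idx₁ : Y₁ → G₁} {φ₁ : K₁ → Y₁ → ℂ} (s₁ : IsFourierSystem R₁ idx₁ φ₁)
    {R₂ : Finset Y₂} {idx₂ : Y₂ → G₂} {φ₂ : K₂ → Y₂ → ℂ} (s₂ : IsFourierSystem R₂ idx₂ φ₂)
    {R₃ : Finset Y₃} {idx₃ : Y₃ → G₃} {φ₃ : K₃ → Y₃ → ℂ} (s₃ : IsFourierSystem R₃ idx₃ φ₃)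
    {F : Y₁ × Y₂ × Y₃ → Y₁ × Y₂ × Y₃ → ℂ}
    (hF : ∀ k l : K₁ × K₂ × K₃, k ≠ 0 → l ≠ 0 → k ≠ l →
      sesq F (fun p => φ₁ k.1 p.1 * (φ₂ k.2.1 p.2.1 * φ₃ k.2.2 p.2.2))
        (fun p => φ₁ l.1 p.1 * (φ₂ l.2.1 p.2.1 * φ₃ l.2.2 p.2.2)) = 0)
    {a₀ a₁ : Y₁} {b₀ b₁ : Y₂} {c₀ c₁ : Y₃} (ha₀ : a₀ ∈ R₁) (ha₁ : a₁ ∈ R₁) (ha : a₁ ≠ a₀)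
    (hb₀ : b₀ ∈ R₂) (hb₁ : b₁ ∈ R₂) (hb : b₁ ≠ b₀) (hc₀ : c₀ ∈ R₃) (hc₁ : c₁ ∈ R₃) (hc : c₁ ≠ c₀)
    (h₃ : ∀ x ∈ R₁ ×ˢ R₂ ×ˢ R₃, ∀ y ∈ R₁ ×ˢ R₂ ×ˢ R₃, x.2.2 = c₀ → y.2.2 ≠ c₀ →
      F x y = 0 ∧ F y x = 0)
    (h₂ : ∀ x ∈ R₁ ×ˢ R₂ ×ˢ R₃, ∀ y ∈ R₁ ×ˢ R₂ ×ˢ R₃, x.2.2 ≠ c₀ → y.2.2 ≠ c₀ → x.2.1 = b₀ →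
      y.2.1 ≠ b₀ → F x y = 0)
    (h₁ : ∀ x ∈ R₁ ×ˢ R₂ ×ˢ R₃, ∀ y ∈ R₁ ×ˢ R₂ ×ˢ R₃, x.2.2 ≠ c₀ → y.2.2 ≠ c₀ → x.2.1 ≠ b₀ →
      y.2.1 ≠ b₀ → x.1 = a₀ → y.1 ≠ a₀ → F x y = 0) :
    (∀ x ∈ R₁ ×ˢ R₂ ×ˢ R₃, ∀ y ∈ R₁ ×ˢ R₂ ×ˢ R₃, x ≠ y → ¬ (x.2.2 = c₀ ∧ y.2.2 = c₀) →
      F x y = 0) ∧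
    ∀ t : ℂ, (∀ x ∈ R₁ ×ˢ R₂ ×ˢ R₃, x.1 ≠ a₀ → x.2.1 ≠ b₀ → x.2.2 ≠ c₀ → F x x = t) →
      (∀ x ∈ R₁ ×ˢ R₂ ×ˢ R₃, x.2.2 ≠ c₀ → F x x = t) ∧
      ∃ r : ℂ, ∀ x ∈ R₁ ×ˢ R₂ ×ˢ R₃, ∀ y ∈ R₁ ×ˢ R₂ ×ˢ R₃, x.2.2 = c₀ → y.2.2 = c₀ →
        F x y = (if x = y then t else 0) + r := by
  classical
  obtain ⟨K, v, u, hK⟩ := (s₁.prod (s₂.prod s₃)).exists_kernel_add hF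
  choose f₁ hf₁ hg₁ using s₁.idx_surj
  choose f₂ hf₂ hg₂ using s₂.idx_surj
  choose f₃ hf₃ hg₃ using s₃.idx_surj
  have k₁ : ∀ x ∈ R₁, f₁ (idx₁ x) = x := fun x hx => s₁.idx_inj _ (hf₁ _) _ hx (hg₁ _)
  have k₂ : ∀ x ∈ R₂, f₂ (idx₂ x) = x := fun x hx => s₂.idx_inj _ (hf₂ _) _ hx (hg₂ _)
  have k₃ : ∀ x ∈ R₃, f₃ (idx₃ x) = x := fun x hx => s₃.idx_inj _ (hf₃ _) _ hx (hg₃ _)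
  have n₁ : ∀ g x, x ∈ R₁ → (f₁ g = x ↔ g = idx₁ x) := fun g x hx =>
    ⟨fun h => by rw [← h, hg₁], fun h => by rw [h, k₁ x hx]⟩
  have n₂ : ∀ g x, x ∈ R₂ → (f₂ g = x ↔ g = idx₂ x) := fun g x hx =>
    ⟨fun h => by rw [← h, hg₂], fun h => by rw [h, k₂ x hx]⟩
  have n₃ : ∀ g x, x ∈ R₃ → (f₃ g = x ↔ g = idx₃ x) := fun g x hx =>
    ⟨fun h => by rw [← h, hg₃], fun h => by rw [h, k₃ x hx]⟩
  let f : G₁ × G₂ × G₃ → Y₁ × Y₂ × Y₃ := fun g => (f₁ g.1, f₂ g.2.1, f₃ g.2.2)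
  let j : Y₁ × Y₂ × Y₃ → G₁ × G₂ × G₃ := fun x => (idx₁ x.1, idx₂ x.2.1, idx₃ x.2.2)
  have hf : ∀ g, f g ∈ R₁ ×ˢ R₂ ×ˢ R₃ := fun g =>
    Finset.mk_mem_product (hf₁ _) (Finset.mk_mem_product (hf₂ _) (hf₃ _))
  have hfj : ∀ x ∈ R₁ ×ˢ R₂ ×ˢ R₃, f (j x) = x := by
    rintro ⟨x, y, z⟩ hx
    rw [Finset.mem_product, Finset.mem_product] at hx
    simp only [f, j, k₁ _ hx.1, k₂ _ hx.2.1, k₃ _ hx.2.2]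
  have hjf : ∀ g, j (f g) = g := fun g => by simp only [f, j, hg₁, hg₂, hg₃]
  have : Finite G₁ := Finite.of_injective f₁ (Function.LeftInverse.injective hg₁)
  have : Finite G₂ := Finite.of_injective f₂ (Function.LeftInverse.injective hg₂)
  have main := _root_.kernel_of_pieces (F := fun g g' => F (f g) (f g')) (K := K)
    (v := fun g => v (f g)) (u := fun g => u (f g)) (a₀ := idx₁ a₀) (a₁ := idx₁ a₁) (b₀ := idx₂ b₀)
    (b₁ := idx₂ b₁) (c₀ := idx₃ c₀) (c₁ := idx₃ c₁)
    (fun x y => by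
      rw [hK _ (hf x) _ (hf y)]
      congr 3
      exact congrArg₂ (· - ·) (hjf x) (hjf y))
    (fun h => ha (s₁.idx_inj _ ha₁ _ ha₀ h)) (fun h => hb (s₂.idx_inj _ hb₁ _ hb₀ h))
    (fun h => hc (s₃.idx_inj _ hc₁ _ hc₀ h))
    (fun x y hx hy => h₃ _ (hf x) _ (hf y) ((n₃ _ _ hc₀).2 hx) (mt (n₃ _ _ hc₀).1 hy))
    (fun x y hx hy hx' hy' => h₂ _ (hf x) _ (hf y) (mt (n₃ _ _ hc₀).1 hx) (mt (n₃ _ _ hc₀).1 hy)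
      ((n₂ _ _ hb₀).2 hx') (mt (n₂ _ _ hb₀).1 hy'))
    (fun x y hx hy hx' hy' hx'' hy'' => h₁ _ (hf x) _ (hf y) (mt (n₃ _ _ hc₀).1 hx)
      (mt (n₃ _ _ hc₀).1 hy) (mt (n₂ _ _ hb₀).1 hx') (mt (n₂ _ _ hb₀).1 hy')
      ((n₁ _ _ ha₀).2 hx'') (mt (n₁ _ _ ha₀).1 hy''))
  have m₃ : ∀ x ∈ R₁ ×ˢ R₂ ×ˢ R₃, ((j x).2.2 = idx₃ c₀ ↔ x.2.2 = c₀) := by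
    intro x hx
    rw [Finset.mem_product, Finset.mem_product] at hx
    exact ⟨fun h => s₃.idx_inj _ hx.2.2 _ hc₀ h, fun h => congrArg idx₃ h⟩
  have mj : ∀ x ∈ R₁ ×ˢ R₂ ×ˢ R₃, ∀ y ∈ R₁ ×ˢ R₂ ×ˢ R₃, (j x = j y ↔ x = y) := fun x hx y hy =>
    ⟨fun h => by rw [← hfj x hx, ← hfj y hy, h], fun h => h ▸ rfl⟩
  refine ⟨fun x hx y hy hxy hn => ?_, fun t ht => ?_⟩
  · have := main.1 (j x) (j y) (mt (mj x hx y hy).1 hxy) (by rwa [m₃ x hx, m₃ y hy])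
    simpa only [hfj x hx, hfj y hy] using this
  · obtain ⟨p₁, r, p₂⟩ := main.2 t (fun g h1 h2 h3 => ht _ (hf g) (mt (n₁ _ _ ha₀).1 h1)
      (mt (n₂ _ _ hb₀).1 h2) (mt (n₃ _ _ hc₀).1 h3))
    refine ⟨fun x hx hxc => ?_, r, fun x hx y hy hxc hyc => ?_⟩
    · have := p₁ (j x) (mt (m₃ x hx).1 hxc)
      simpa only [hfj x hx] using this
    · have := p₂ (j x) (j y) ((m₃ x hx).2 hxc) ((m₃ y hy).2 hyc)
      simpa only [hfj x hx, hfj y hy, mj x hx y hy] using this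

/-! ### Combinatorics of the blocks seen by three parties -/

/-- Whether a coordinate of type `t` (one of the two ends, or between them) lies in the side of a
block that has the end `c`, and all interior points if `ext` holds. -/
def fits (t : Option Bool) (c ext : Bool) : Bool :=
  match t with
  | some b => b == c
  | none => ext

/-- Whether a cell of type `t` lies in the projection to the last three parties of the block with
corner `(a, b, c, e)`. -/
def fitsBox (a b c e : Bool) (t : Option Bool × Option Bool × Option Bool) : Bool :=
  fits t.1 b (xor b c) && fits t.2.1 c (xor c e) && fits t.2.2 e (!(xor e a))

/-- The blocks `(!b, b, c, e)` are those that are long in the first party. -/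
theorem exists_fitsBox : ∀ t : Option Bool × Option Bool × Option Bool, t ≠ (none, none, none) →
    ∃ b c e, fitsBox (!b) b c e t = true := by
  decide

/-- A Hermitian kernel with the relations that the blocks and the stopper impose on it is a multiple
of the identity. -/
theorem kernel_scalar {P : Type*} [Fintype P] [DecidableEq P]
    {τ : P → Option Bool × Option Bool × Option Bool} (hτ : Function.Surjective τ)
    (hcorner : ∀ x y a, τ x = (some a, some a, some a) → τ y = (some a, some a, some a) → x = y)
    {E : P → P → ℂ} (herm : ∀ x y, E y x = conj (E x y))
    (hQQ : ∀ b c e b' c' e' x y, (b, c, e) ≠ (b', c', e') → fitsBox (!b) b c e (τ x) →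
      fitsBox (!b') b' c' e' (τ y) → E x y = 0)
    (hQW : ∀ b c e c' e' x x' y, fitsBox (!b) (!b) c' e' (τ x) → fitsBox (!b) (!b) c' e' (τ x') →
      fitsBox (!b) b c e (τ y) → E x y = E x' y)
    (hWW : ∀ a c e c' e' x x' y y', (c, e) ≠ (c', e') → fitsBox a a c e (τ x) →
      fitsBox a a c e (τ x') → fitsBox a a c' e' (τ y) → fitsBox a a c' e' (τ y') →
      E x y - E x' y = E x y' - E x' y')
    (hQ : ∀ b c e t x, fitsBox (!b) b c e (τ x) →
      (∀ y, fitsBox (!b) b c e (τ y) → E y x = if y = x then t else 0) →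
      ∀ y z, fitsBox (!b) b c e (τ y) → fitsBox (!b) b c e (τ z) → E y z = if y = z then t else 0)
    (hsum : ∀ a b c e y y', fitsBox a b c e (τ y) → fitsBox a b c e (τ y') →
      ∑ x, E x y = ∑ x, E x y')
    (hW : ∀ a, (∀ x y, fitsBox a a (!a) a (τ x) → fitsBox a a (!a) a (τ y) →
        (∃ b c e, fitsBox (!b) b c e (τ x) ≠ fitsBox (!b) b c e (τ y)) → E x y = 0) →
      (∀ x y, fitsBox a a (!a) a (τ x) → fitsBox a a (!a) a (τ y) → x ≠ y →
        ¬ ((τ x).2.2 = some a ∧ (τ y).2.2 = some a) → E x y = 0) ∧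
      ∀ t, (∀ x, τ x = (none, none, none) → E x x = t) →
        (∀ x, fitsBox a a (!a) a (τ x) → (τ x).2.2 ≠ some a → E x x = t) ∧
        ∃ r, ∀ x y, fitsBox a a (!a) a (τ x) → fitsBox a a (!a) a (τ y) → (τ x).2.2 = some a →
          (τ y).2.2 = some a → E x y = (if x = y then t else 0) + r) :
    ∃ t, ∀ x y, E x y = if x = y then t else 0 := by
  -- the kernel vanishes between different blocks
  have hin : ∀ b c e x y, fitsBox (!b) b c e (τ x) → τ y = (none, none, none) → E y x = 0 := by
    intro b c e x y hx hy
    obtain ⟨y', hy'⟩ := hτ (some (!b), none, none)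
    -- The short block `(!b, !b, b, !b)` contains the interior; along it `y` may be moved to `y'`,
    -- which lies in another long block.
    rw [hQW b c e b (!b) y y' x (by rw [hy]; clear * -; revert b; decide) (by rw [hy']; clear * -; revert b; decide) hx]
    exact hQQ (!b) (!b) b b c e y' x (by simp) (by rw [hy']; clear * -; revert b; decide) hx
  have cross₁ : ∀ b c e x y, fitsBox (!b) b c e (τ x) → ¬ fitsBox (!b) b c e (τ y) →
      E y x = 0 := by
    intro b c e x y hx hy
    by_cases h : τ y = (none, none, none)
    · exact hin b c e x y hx h
    · obtain ⟨b', c', e', h'⟩ := exists_fitsBox _ h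
      refine hQQ b' c' e' b c e y x (fun h'' => hy ?_) h' hx
      simp only [Prod.mk.injEq] at h''
      obtain ⟨rfl, rfl, rfl⟩ := h''
      exact h'
  have cross : ∀ x y, (∃ b c e, fitsBox (!b) b c e (τ x) ≠ fitsBox (!b) b c e (τ y)) →
      E x y = 0 := by
    rintro x y ⟨b, c, e, h⟩
    cases hx : fitsBox (!b) b c e (τ x)
    · refine cross₁ b c e y x ?_ (by rw [hx]; simp)
      rw [hx] at h
      simpa using h.symm
    · rw [herm y x, cross₁ b c e x y hx, map_zero]
      rw [hx] at h
      simpa using h.symm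
  -- column sums
  obtain ⟨m, hm⟩ := hτ (none, none, none)
  set t := ∑ x, E x m with ht
  have hsW : ∀ a y, fitsBox a a (!a) a (τ y) → ∑ x, E x y = t := fun a y hy =>
    hsum a a (!a) a y m hy (by rw [hm]; clear * -; revert a; decide)
  have hsQ : ∀ b c e y t', fitsBox (!b) b c e (τ y) → fitsBox (!b) b c e t' →
      fitsBox b b (!b) b t' → ∑ x, E x y = t := by
    intro b c e y t' hy ht' ht''
    obtain ⟨y', rfl⟩ := hτ t'
    rw [hsum _ _ _ _ y y' hy ht', hsW b y' ht'']
  have hsQ' : ∀ b c e y, (b, c, e) ≠ (b, b, b) → fitsBox (!b) b c e (τ y) → ∑ x, E x y = t := by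
    intro b c e y hne hy
    -- Column sums spread from the interior through overlapping projections.
    obtain ⟨t', h1, h2⟩ : ∃ t', fitsBox (!b) b c e t' = true ∧ fitsBox b b (!b) b t' = true := by
      clear hy
      revert b c e
      decide
    exact hsQ b c e y t' hy h1 h2
  have hs : ∀ y, ∑ x, E x y = t := by
    intro y
    by_cases h : τ y = (none, none, none)
    · exact hsW true y (by rw [h]; decide)
    · obtain ⟨b, c, e, h'⟩ := exists_fitsBox _ h
      by_cases hb : (b, c, e) = (b, b, b)
      · simp only [Prod.mk.injEq, true_and] at hb
        obtain ⟨rfl, rfl⟩ := hb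
        -- The single corner cell misses the large block; the edge block `(e, e, e, e)` links it to
        -- a long block that is already treated.
        obtain ⟨y', hy'⟩ := hτ (some e, some e, none)
        have hy : fitsBox e e e e (τ y) := by
          revert h'
          generalize τ y = s
          clear * -
          revert e s
          decide
        rw [hsum e e e e y y' hy (by rw [hy']; clear * -; revert e; decide)]
        exact hsQ' e e (!e) y' (by simp) (by rw [hy']; clear * -; revert e; decide)
      · exact hsQ' b c e y hb h'
  have inter : ∀ x y, τ x = (none, none, none) → y ≠ x → E y x = 0 := by
    intro x y hx hyx
    by_cases h : τ y = (none, none, none)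
    · refine (hW true fun x y _ _ => cross x y).1 y x (by rw [h]; decide) (by rw [hx]; decide) hyx ?_
      rw [h]
      simp
    · obtain ⟨b, c, e, h'⟩ := exists_fitsBox _ h
      rw [herm x y, hin b c e y x h' hx, map_zero]
  have inter' : ∀ x, τ x = (none, none, none) → E x x = t := by
    intro x hx
    rw [← hs x]
    exact (Finset.sum_eq_single x (fun y _ hyx => inter x y hx hyx) (by simp)).symm
  have colQ : ∀ b c e x, fitsBox (!b) b c e (τ x) →
      ∑ y, (if fitsBox (!b) b c e (τ y) then E y x else 0) = t := by
    intro b c e x hx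
    rw [← hs x]
    refine Finset.sum_congr rfl fun y _ => ?_
    split_ifs with h
    · rfl
    · exact (cross₁ b c e x y hx h).symm
  -- the blocks that contain the interior
  have big : ∀ a x y, fitsBox a a (!a) a (τ x) → fitsBox a a (!a) a (τ y) →
      E x y = if x = y then t else 0 := by
    intro a
    obtain ⟨h1, h2⟩ := hW a fun x y _ _ => cross x y
    obtain ⟨h3, r, h4⟩ := h2 t inter'
    have hp : ∀ s, fitsBox (!a) a (!a) a s = true ↔ (fitsBox a a (!a) a s = true ∧
        s.2.2 = some a) := by
      clear h1 h2 h3 h4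
      revert a
      decide
    -- The layer carrying `r` is the projection of a long block, so its columns sum to `t`, while
    -- `r` would add a positive multiple of itself.
    have hr : r = 0 := by
      obtain ⟨x, hx⟩ := hτ (none, none, some a)
      have hx' : fitsBox (!a) a (!a) a (τ x) := by
        rw [hx]
        clear * -
        revert a
        decide
      have h5 := colQ a (!a) a x hx'
      have h6 : ∀ y, (if fitsBox (!a) a (!a) a (τ y) then E y x else 0) =
          (if y = x then t else 0) + if fitsBox (!a) a (!a) a (τ y) then r else 0 := by
        intro y
        split_ifs with h7 h8 h8
        · rw [h4 y x ((hp _).1 h7).1 ((hp _).1 hx').1 ((hp _).1 h7).2 ((hp _).1 hx').2, if_pos h8]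
        · rw [h4 y x ((hp _).1 h7).1 ((hp _).1 hx').1 ((hp _).1 h7).2 ((hp _).1 hx').2, if_neg h8]
        · exact absurd (h8 ▸ hx') h7
        · simp
      rw [Finset.sum_congr rfl fun y _ => h6 y, Finset.sum_add_distrib, Finset.sum_ite_eq',
        if_pos (Finset.mem_univ _), add_eq_left, ← Finset.sum_filter, Finset.sum_const,
        nsmul_eq_mul, mul_eq_zero] at h5
      refine h5.resolve_left ?_
      have : 0 < #{y | fitsBox (!a) a (!a) a (τ y) = true} :=
        Finset.card_pos.2 ⟨x, by simpa using hx'⟩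
      exact_mod_cast this.ne'
    intro x y hx hy
    by_cases hxy : x = y
    · subst hxy
      rw [if_pos rfl]
      by_cases hc : (τ x).2.2 = some a
      · rw [h4 x x hx hx hc hc, hr, if_pos rfl, add_zero]
      · exact h3 x hx hc
    · rw [if_neg hxy]
      by_cases hc : (τ x).2.2 = some a ∧ (τ y).2.2 = some a
      · rw [h4 x y hx hy hc.1 hc.2, hr, if_neg hxy, add_zero]
      · exact h1 x y hx hy hxy hc
  -- the other blocks
  have col : ∀ a c x, fitsBox (!a) a c (!a) (τ x) → fitsBox a a (!a) a (τ x) →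
      ∀ y, fitsBox (!a) a c (!a) (τ y) → E y x = if y = x then t else 0 := by
    intro a c x hxQ hxW
    -- Outside the large block, the long block consists of its face `V` at the end `!a` of the last
    -- coordinate, which is itself a short block, and of cells of the short block `(a, a, a, a)`.
    have hVW : ∀ s, fitsBox a a c (!a) s = true → fitsBox a a (!a) a s = false := by
      clear * -
      revert a c
      decide
    have hVQ : ∀ s, fitsBox a a c (!a) s = true → fitsBox (!a) a c (!a) s = true := by
      clear * -
      revert a c
      decide
    have hrest : ∀ s, fitsBox (!a) a c (!a) s = true → fitsBox a a c (!a) s = false →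
        fitsBox a a (!a) a s = false → fitsBox a a a a s = true := by
      clear * -
      revert a c
      decide
    obtain ⟨v, hv⟩ : ∃ v, fitsBox a a c (!a) (τ v) = true := by
      obtain ⟨s, hs'⟩ : ∃ s, fitsBox a a c (!a) s = true := by
        clear * -
        revert a c
        decide
      obtain ⟨v, rfl⟩ := hτ s
      exact ⟨v, hs'⟩
    have hmW : fitsBox a a (!a) a (τ m) := by
      rw [hm]
      clear * -
      revert a
      decide
    have ne_m : ∀ y c' e', (c', e') ≠ (!a, a) → fitsBox a a c' e' (τ y) → y ≠ m := by
      rintro y c' e' hne hy rfl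
      rw [hm] at hy
      revert hy hne
      clear * -
      revert a c' e'
      decide
    have hconst : ∀ c' e' y y', (c', e') ≠ (!a, a) → fitsBox a a c' e' (τ y) →
        fitsBox a a c' e' (τ y') → E y x = E y' x := by
      intro c' e' y y' hne hy hy'
      -- Mixed differences compare the column of `x` with that of the interior cell `m`, which
      -- vanishes off the diagonal.
      have := hWW a c' e' (!a) a y y' x m hne hy hy' hxW hmW
      rw [inter m y hm (ne_m y c' e' hne hy), inter m y' hm (ne_m y' c' e' hne hy'), sub_self,
        sub_eq_zero] at this
      exact this
    have hval : ∀ y, fitsBox (!a) a c (!a) (τ y) →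
        E y x = (if y = x then t else 0) + if fitsBox a a c (!a) (τ y) then E v x else 0 := by
      intro y hy
      by_cases hyW : fitsBox a a (!a) a (τ y) = true
      · rw [big a y x hyW hxW]
        have : ¬ fitsBox a a c (!a) (τ y) = true := fun h => by
          rw [hVW _ h] at hyW
          exact absurd hyW (by simp)
        rw [if_neg this, add_zero]
      · have hyx : y ≠ x := fun h => hyW (h ▸ hxW)
        rw [if_neg hyx, zero_add]
        by_cases hyV : fitsBox a a c (!a) (τ y) = true
        · rw [if_pos hyV]
          exact hconst c (!a) y v (by simp) hyV hv
        · rw [if_neg hyV]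
          have hy' := hrest _ hy (by simpa using hyV) (by simpa using hyW)
          -- The corner `z` shares the short block with `y` but lies outside the long one, so the
          -- constant is zero.
          obtain ⟨z, hz⟩ := hτ (some a, some a, some a)
          rw [hconst a a y z (by simp) hy' (by rw [hz]; clear * -; revert a; decide)]
          refine cross₁ a c (!a) x z hxQ ?_
          rw [hz]
          clear * -
          revert a c
          decide
    have hv0 : E v x = 0 := by
      have h5 := colQ a c (!a) x hxQ
      have h6 : ∀ y, (if fitsBox (!a) a c (!a) (τ y) then E y x else 0) =
          (if y = x then t else 0) + if fitsBox a a c (!a) (τ y) then E v x else 0 := by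
        intro y
        by_cases hy : fitsBox (!a) a c (!a) (τ y) = true
        · rw [if_pos hy, hval y hy]
        · rw [if_neg hy, if_neg (fun h => hy (by rw [h]; exact hxQ)), if_neg (fun h => hy (hVQ _ h)),
            add_zero]
      rw [Finset.sum_congr rfl fun y _ => h6 y, Finset.sum_add_distrib, Finset.sum_ite_eq',
        if_pos (Finset.mem_univ _), add_eq_left, ← Finset.sum_filter, Finset.sum_const,
        nsmul_eq_mul, mul_eq_zero] at h5
      refine h5.resolve_left ?_
      have : 0 < #{y | fitsBox a a c (!a) (τ y) = true} := Finset.card_pos.2 ⟨v, by simpa using hv⟩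
      exact_mod_cast this.ne'
    intro y hy
    rw [hval y hy, hv0]
    simp
  have other : ∀ b c e x y, fitsBox (!b) b c e (τ x) → fitsBox (!b) b c e (τ y) →
      E x y = if x = y then t else 0 := by
    intro b c e x y hx hy
    by_cases he : e = b
    · subst he
      by_cases hc : c = e
      · subst hc
        have hone : ∀ s, fitsBox (!c) c c c s = true → s = (some c, some c, some c) := by
          clear * -
          revert c
          decide
        obtain rfl : x = y := hcorner x y c (hone _ hx) (hone _ hy)
        rw [if_pos rfl, ← colQ c c c x hx, Finset.sum_eq_single x, if_pos hx]
        · intro z _ hz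
          exact if_neg fun h => hz (hcorner z x c (hone _ h) (hone _ hx))
        · simp
      · obtain rfl : c = !e := by revert hc; clear * -; revert c e; decide
        have hsub : ∀ s, fitsBox (!e) e (!e) e s = true → fitsBox e e (!e) e s = true := by
          clear * -
          revert e
          decide
        exact big e x y (hsub _ hx) (hsub _ hy)
    · obtain rfl : e = !b := by revert he; clear * -; revert b e; decide
      obtain ⟨s, h1, h2⟩ : ∃ s, fitsBox (!b) b c (!b) s = true ∧ fitsBox b b (!b) b s = true := by
        clear * -
        revert b c
        decide
      obtain ⟨x₀, rfl⟩ := hτ s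
      exact hQ b c (!b) t x₀ h1 (col b c x₀ h1 h2) x y hx hy
  refine ⟨t, fun x y => ?_⟩
  by_cases hy : τ y = (none, none, none)
  · by_cases hxy : x = y
    · rw [if_pos hxy, hxy, inter' y hy]
    · rw [if_neg hxy, inter y x hy hxy]
  · obtain ⟨b, c, e, h⟩ := exists_fitsBox _ hy
    by_cases hx : fitsBox (!b) b c e (τ x) = true
    · exact other b c e x y hx h
    · rw [cross₁ b c e y x h hx, if_neg fun hxy => hx (by rw [hxy]; exact h)]

/-! ### Ends and sides of one coordinate -/

section

variable {X : Type*} [DecidableEq X]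

/-- Which of the two ends a point is; `none` for the points between them. -/
def endType (e : Bool → X) (x : X) : Option Bool :=
  if x = e false then some false else if x = e true then some true else none

theorem endType_eq_some {e : Bool → X} (he : Function.Injective e) {x : X} {b : Bool} :
    endType e x = some b ↔ x = e b := by
  have h : e false ≠ e true := fun h => absurd (he h) (by simp)
  unfold endType
  split_ifs with h1 h2
  · subst h1
    cases b <;> simp [h]
  · subst h2
    cases b <;> simp [h.symm]
  · cases b <;> simp [h1, h2]

theorem exists_endType {e : Bool → X} (he : Function.Injective e) {m : X} (hm : ∀ b, m ≠ e b)
    (t : Option Bool) : ∃ x, endType e x = t := by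
  cases t with
  | none => exact ⟨m, by simp [endType, hm]⟩
  | some b => exact ⟨e b, (endType_eq_some he).2 rfl⟩

variable [Fintype X]

/-- The side of a block at the end `e c` of a coordinate: the end itself, together with all points
between the two ends if `ext` holds. -/
def side (e : Bool → X) (c ext : Bool) : Finset X :=
  if ext then univ.erase (e !c) else {e c}

theorem mem_side {e : Bool → X} (he : Function.Injective e) {x : X} {c ext : Bool} :
    x ∈ side e c ext ↔ fits (endType e x) c ext = true := by
  have h : ∀ b, endType e x = some b ↔ x = e b := fun b => endType_eq_some he
  unfold side
  cases ht : endType e x with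
  | none =>
    have hn : ∀ b, x ≠ e b := fun b hb => by simp [(h b).2 hb] at ht
    cases ext <;> simp [fits, hn]
  | some b =>
    obtain rfl := (h b).1 ht
    cases ext <;> cases b <;> cases c <;> simp [fits, he.eq_iff]

theorem end_mem_side {e : Bool → X} (he : Function.Injective e) (c ext : Bool) :
    e c ∈ side e c ext := by
  rw [mem_side he, (endType_eq_some he).2 rfl]
  simp [fits]

theorem side_nonempty {e : Bool → X} (he : Function.Injective e) (c ext : Bool) :
    (side e c ext).Nonempty :=
  ⟨_, end_mem_side he c ext⟩

theorem isFourierSystem_side {e : Bool → X} (he : Function.Injective e) (c ext : Bool) :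
    IsFourierSystem (side e c ext) (residueIndex (side e c ext)) (fourierVec (side e c ext)) :=
  isFourierSystem_fourierVec (side_nonempty he c ext)

end

/-! ### From orthogonality of the states to relations on the kernel -/

section

variable {A B C D : Type*} [Fintype A] [DecidableEq A] [Fintype B] [DecidableEq B] [Fintype C]
  [DecidableEq C] [Fintype D] [DecidableEq D]

/-- The projection to the last three parties of the block with corner `(a, b, c, e)`. -/
def boxSet (eB : Bool → B) (eC : Bool → C) (eD : Bool → D) (a b c e : Bool) :
    Finset (B × C × D) :=
  side eB b (xor b c) ×ˢ side eC c (xor c e) ×ˢ side eD e (!(xor e a))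

/-- The frequencies of the Fourier basis of `boxSet`. -/
abbrev BoxFreq (eB : Bool → B) (eC : Bool → C) (eD : Bool → D) (a b c e : Bool) : Type :=
  ZMod (#(side eB b (xor b c)) - 1 + 1) × ZMod (#(side eC c (xor c e)) - 1 + 1) ×
    ZMod (#(side eD e (!(xor e a))) - 1 + 1)

/-- The product Fourier basis of `boxSet`. -/
noncomputable def boxVec (eB : Bool → B) (eC : Bool → C) (eD : Bool → D) (a b c e : Bool)
    (k : BoxFreq eB eC eD a b c e) (p : B × C × D) : ℂ :=
  fourierVec (side eB b (xor b c)) k.1 p.1 * (fourierVec (side eC c (xor c e)) k.2.1 p.2.1 *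
    fourierVec (side eD e (!(xor e a))) k.2.2 p.2.2)

variable {eA : Bool → A} {eB : Bool → B} {eC : Bool → C} {eD : Bool → D}

theorem isFourierSystem_boxVec (hB : Function.Injective eB) (hC : Function.Injective eC)
    (hD : Function.Injective eD) (a b c e : Bool) :
    IsFourierSystem (boxSet eB eC eD a b c e)
      (fun p : B × C × D => (residueIndex (side eB b (xor b c)) p.1,
        residueIndex (side eC c (xor c e)) p.2.1, residueIndex (side eD e (!(xor e a))) p.2.2))
      (boxVec eB eC eD a b c e) :=
  (isFourierSystem_side hB _ _).prod ((isFourierSystem_side hC _ _).prod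
    (isFourierSystem_side hD _ _))

/-- The types of the three coordinates of a cell. -/
def cellType (eB : Bool → B) (eC : Bool → C) (eD : Bool → D) (p : B × C × D) :
    Option Bool × Option Bool × Option Bool :=
  (endType eB p.1, endType eC p.2.1, endType eD p.2.2)

theorem mem_boxSet (hB : Function.Injective eB) (hC : Function.Injective eC)
    (hD : Function.Injective eD) {a b c e : Bool} {p : B × C × D} :
    p ∈ boxSet eB eC eD a b c e ↔ fitsBox a b c e (cellType eB eC eD p) = true := by
  simp only [boxSet, Finset.mem_product, mem_side hB, mem_side hC, mem_side hD, fitsBox, cellType,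
    Bool.and_eq_true, and_assoc]

/-- A Hermitian kernel on the last three parties that preserves the orthogonality of the product
Fourier states of all blocks of the outer layer and of the stopper is a multiple of the identity. -/
theorem kernel_scalar_of_states (hA : Function.Injective eA) (hB : Function.Injective eB)
    (hC : Function.Injective eC) (hD : Function.Injective eD)
    {mA : A} (hmA : ∀ b, mA ≠ eA b) {mB : B} (hmB : ∀ b, mB ≠ eB b)
    {mC : C} (hmC : ∀ b, mC ≠ eC b) {mD : D} (hmD : ∀ b, mD ≠ eD b)
    {E : B × C × D → B × C × D → ℂ} (herm : ∀ x y, E y x = conj (E x y))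
    (hdiff : ∀ a b c e a' b' c' e' (kA : ZMod (#(side eA a (xor a b)) - 1 + 1))
      (k : BoxFreq eB eC eD a b c e) (kA' : ZMod (#(side eA a' (xor a' b')) - 1 + 1))
      (k' : BoxFreq eB eC eD a' b' c' e'), (a, b, c, e) ≠ (a', b', c', e') →
      (kA, k) ≠ 0 → (kA', k') ≠ 0 →
      (∑ x, conj (fourierVec _ kA x) * fourierVec _ kA' x) *
        sesq E (boxVec eB eC eD a b c e k) (boxVec eB eC eD a' b' c' e' k') = 0)
    (hsame : ∀ a b c e (kA kA' : ZMod (#(side eA a (xor a b)) - 1 + 1))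
      (k k' : BoxFreq eB eC eD a b c e), (kA, k) ≠ (kA', k') →
      (kA, k) ≠ 0 → (kA', k') ≠ 0 →
      (∑ x, conj (fourierVec _ kA x) * fourierVec _ kA' x) *
        sesq E (boxVec eB eC eD a b c e k) (boxVec eB eC eD a b c e k') = 0)
    (hstopper : ∀ a b c e (kA : ZMod (#(side eA a (xor a b)) - 1 + 1))
      (k : BoxFreq eB eC eD a b c e), (kA, k) ≠ 0 →
      (∑ x, fourierVec _ kA x) * sesq E (fun _ => 1) (boxVec eB eC eD a b c e k) = 0) :
    ∃ t, ∀ x y, E x y = if x = y then t else 0 := by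
  have sA := fun a b => isFourierSystem_side hA a (xor a b)
  have sP := isFourierSystem_boxVec hB hC hD
  have mem := fun {a b c e : Bool} {p : B × C × D} =>
    mem_boxSet hB hC hD (a := a) (b := b) (c := c) (e := e) (p := p)
  -- All long sides contain the point `mA`, so any two of them intersect.
  have midA : ∀ b, mA ∈ side eA (!b) (xor (!b) b) := fun b => by
    rw [mem_side hA]
    simp [endType, hmA, fits]
  have h0A : ∀ a b, ∑ x, conj (fourierVec (side eA a (xor a b)) 0 x) *
      fourierVec (side eA a (xor a b)) 0 x ≠ 0 := by
    intro a b
    rw [(sA a b).orth 0 0, if_pos rfl]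
    exact (sA a b).card_ne_zero
  refine kernel_scalar (τ := cellType eB eC eD) ?_ ?_ herm ?_ ?_ ?_ ?_ ?_ ?_
  · rintro ⟨t₁, t₂, t₃⟩
    obtain ⟨x, rfl⟩ := exists_endType hB hmB t₁
    obtain ⟨y, rfl⟩ := exists_endType hC hmC t₂
    obtain ⟨z, rfl⟩ := exists_endType hD hmD t₃
    exact ⟨(x, y, z), rfl⟩
  · rintro ⟨x, y, z⟩ ⟨x', y', z'⟩ a h h'
    simp only [cellType, Prod.mk.injEq, endType_eq_some hB, endType_eq_some hC,
      endType_eq_some hD] at h h'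
    rw [h.1, h.2.1, h.2.2, h'.1, h'.2.1, h'.2.2]
  · intro b c e b' c' e' x y hne hx hy
    obtain ⟨kA, kA', hk, hk', hn⟩ := (sA (!b) b).exists_inner_ne_zero (sA (!b') b') (midA b)
      (midA b') (end_mem_side hA (!b) _) (hmA _) (end_mem_side hA (!b') _) (hmA _)
    refine (sP (!b) b c e).kernel_eq_zero (sP (!b') b' c' e') (fun k l => ?_) (mem.2 hx) (mem.2 hy)
    refine (mul_eq_zero.1 (hdiff _ _ _ _ _ _ _ _ kA k kA' l ?_ ?_ ?_)).resolve_left hn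
    · exact fun h => hne (Prod.mk.inj h).2
    · exact fun h => hk (Prod.mk.inj h).1
    · exact fun h => hk' (Prod.mk.inj h).1
  · intro b c e c' e' x x' y hx hx' hy
    obtain ⟨kA', hk'⟩ := (sA (!b) b).exists_ne_zero_freq (midA b) (end_mem_side hA (!b) _) (hmA _)
    have hn : ∑ z, conj (fourierVec (side eA (!b) (xor (!b) (!b))) 0 z) * fourierVec _ kA' z ≠ 0 := by
      rw [Finset.sum_eq_single (eA !b)]
      · rw [(sA (!b) (!b)).zero _ (end_mem_side hA _ _), map_one, one_mul]
        exact (sA (!b) b).ne_zero _ (end_mem_side hA _ _)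
      · intro z _ hz
        rw [(sA (!b) (!b)).supp, map_zero, zero_mul]
        rw [mem_side hA]
        intro h
        apply hz
        rw [← endType_eq_some hA]
        revert h
        generalize endType eA z = s
        clear * -
        revert b s
        decide
      · simp
    refine (sP (!b) (!b) c' e').kernel_const_left (sP (!b) b c e) (fun k l hk => ?_) (mem.2 hx)
      (mem.2 hx') (mem.2 hy)
    refine (mul_eq_zero.1 (hdiff _ _ _ _ _ _ _ _ 0 k kA' l ?_ ?_ ?_)).resolve_left hn
    · simp
    · exact fun h => hk (Prod.mk.inj h).2
    · exact fun h => hk' (Prod.mk.inj h).1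
  · intro a c e c' e' x x' y y' hne hx hx' hy hy'
    refine (sP a a c e).kernel_second_difference (sP a a c' e') (fun k l hk hl => ?_) (mem.2 hx)
      (mem.2 hx') (mem.2 hy) (mem.2 hy')
    refine (mul_eq_zero.1 (hdiff _ _ _ _ _ _ _ _ 0 k 0 l ?_ ?_ ?_)).resolve_left (h0A a a)
    · exact fun h => hne (Prod.mk.inj (Prod.mk.inj h).2).2
    · exact fun h => hk (Prod.mk.inj h).2
    · exact fun h => hl (Prod.mk.inj h).2
  · intro b c e t x hx hcol y z hy hz
    obtain ⟨kA, hk⟩ := (sA (!b) b).exists_ne_zero_freq (midA b) (end_mem_side hA (!b) _) (hmA _)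
    refine (sP (!b) b c e).kernel_scalar_of_column (fun k l hkl => ?_) (mem.2 hx)
      (fun y hy => hcol y (mem.1 hy)) (mem.2 hy) (mem.2 hz)
    -- A fixed nonzero frequency of the first party makes every frequency of the other three
    -- available, including zero.
    refine (mul_eq_zero.1 (hsame _ _ _ _ kA kA k l ?_ ?_ ?_)).resolve_left ?_
    · exact fun h => hkl (Prod.mk.inj h).2
    · exact fun h => hk (Prod.mk.inj h).1
    · exact fun h => hk (Prod.mk.inj h).1
    · rw [(sA (!b) b).orth, if_pos rfl]
      exact (sA (!b) b).card_ne_zero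
  · intro a b c e y y' hy hy'
    refine (sP a b c e).const' (g := fun y => ∑ x, E x y) (fun k hk => ?_) (mem.2 hy) (mem.2 hy')
    have := (mul_eq_zero.1 (hstopper a b c e 0 k fun h => hk (Prod.mk.inj h).2)).resolve_left
      (by rw [(sA a b).sum_zero_freq]; exact (sA a b).card_ne_zero)
    rw [← this, sesq, Finset.sum_comm]
    refine Finset.sum_congr rfl fun y _ => ?_
    rw [Finset.sum_mul]
    simp
  · intro a hcross
    have tp : ∀ p ∈ boxSet eB eC eD a a (!a) a, ∀ q ∈ boxSet eB eC eD a a (!a) a,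
        (∃ b c e, fitsBox (!b) b c e (cellType eB eC eD p) ≠
          fitsBox (!b) b c e (cellType eB eC eD q)) → E p q = 0 :=
      fun p hp q hq => hcross p q (mem.1 hp) (mem.1 hq)
    have hm₁ : mB ∈ side eB a (xor a !a) := by
      rw [mem_side hB]
      simp [endType, hmB, fits]
    have hm₂ : mC ∈ side eC (!a) (xor (!a) a) := by
      rw [mem_side hC]
      simp [endType, hmC, fits]
    have hm₃ : mD ∈ side eD a (!(xor a a)) := by
      rw [mem_side hD]
      simp [endType, hmD, fits]
    have piece : ∀ p ∈ boxSet eB eC eD a a (!a) a, ∀ q ∈ boxSet eB eC eD a a (!a) a,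
        ((p.2.2 = eD a ∧ q.2.2 ≠ eD a) ∨ (p.2.2 ≠ eD a ∧ q.2.2 = eD a) ∨
        (p.2.2 ≠ eD a ∧ q.2.2 ≠ eD a ∧ p.2.1 = eC !a ∧ q.2.1 ≠ eC !a) ∨
        (p.2.2 ≠ eD a ∧ q.2.2 ≠ eD a ∧ p.2.1 ≠ eC !a ∧ q.2.1 ≠ eC !a ∧ p.1 = eB a ∧ q.1 ≠ eB a)) →
        E p q = 0 := by
      intro p hp q hq h
      refine tp p hp q hq ?_
      have hp' := mem.1 hp
      have hq' := mem.1 hq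
      simp only [← endType_eq_some hD, ← endType_eq_some hC, ← endType_eq_some hB, ne_eq] at h
      -- Three long blocks cut the large block exactly into the pieces of `kernel_of_pieces`.
      have key : ∀ s, fitsBox a a (!a) a s = true →
          (fitsBox (!a) a (!a) a s = true ↔ s.2.2 = some a) ∧
          (fitsBox (!a) a (!a) (!a) s = true ↔ s.2.2 ≠ some a ∧ s.2.1 = some !a) ∧
          (fitsBox (!a) a a (!a) s = true ↔ s.2.2 ≠ some a ∧ s.2.1 ≠ some !a ∧ s.1 = some a) := by
        clear * -
        revert a
        decide
      obtain ⟨p1, p2, p3⟩ := key _ hp'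
      obtain ⟨q1, q2, q3⟩ := key _ hq'
      rcases h with h | h | h | h
      · refine ⟨a, !a, a, fun e => ?_⟩
        rw [← Bool.coe_iff_coe, p1, q1] at e
        exact h.2 (e.1 h.1)
      · refine ⟨a, !a, a, fun e => ?_⟩
        rw [← Bool.coe_iff_coe, p1, q1] at e
        exact h.1 (e.2 h.2)
      · refine ⟨a, !a, !a, fun e => ?_⟩
        rw [← Bool.coe_iff_coe, p2, q2] at e
        exact h.2.2.2 (e.1 ⟨h.1, h.2.2.1⟩).2
      · refine ⟨a, a, !a, fun e => ?_⟩
        rw [← Bool.coe_iff_coe, p3, q3] at e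
        exact h.2.2.2.2.2 (e.1 ⟨h.1, h.2.2.1, h.2.2.2.2.1⟩).2.2
    have main := IsFourierSystem.kernel_of_pieces (isFourierSystem_side hB a (xor a !a))
      (isFourierSystem_side hC (!a) (xor (!a) a)) (isFourierSystem_side hD a (!(xor a a))) (F := E)
      (fun k l hk hl hkl => (mul_eq_zero.1 (hsame a a (!a) a 0 0 k l
        (fun h => hkl (Prod.mk.inj h).2) (fun h => hk (Prod.mk.inj h).2)
        (fun h => hl (Prod.mk.inj h).2))).resolve_left (h0A a a))
      (end_mem_side hB a _) hm₁ (hmB a) (end_mem_side hC (!a) _) hm₂ (hmC _) (end_mem_side hD a _)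
      hm₃ (hmD a)
      (fun x hx y hy h h' => ⟨piece x hx y hy (Or.inl ⟨h, h'⟩),
        piece y hy x hx (Or.inr (Or.inl ⟨h', h⟩))⟩)
      (fun x hx y hy h h' h2 h2' => piece x hx y hy (Or.inr (Or.inr (Or.inl ⟨h, h', h2, h2'⟩))))
      (fun x hx y hy h h' h2 h2' h3 h3' => piece x hx y hy
        (Or.inr (Or.inr (Or.inr ⟨h, h', h2, h2', h3, h3'⟩))))
    simp only [cellType, ne_eq, endType_eq_some hD]
    refine ⟨fun x y hx hy => main.1 x (mem.2 hx) y (mem.2 hy), fun t ht => ?_⟩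
    obtain ⟨h1, r, h2⟩ := main.2 t (fun x hx n1 n2 n3 => ht x (by
      have hx' := mem.1 hx
      rw [ne_eq, ← endType_eq_some hB] at n1
      rw [ne_eq, ← endType_eq_some hC] at n2
      rw [ne_eq, ← endType_eq_some hD] at n3
      revert hx' n1 n2 n3
      unfold cellType
      generalize endType eB x.1 = s₁
      generalize endType eC x.2.1 = s₂
      generalize endType eD x.2.2 = s₃
      clear * -
      revert a s₁ s₂ s₃
      decide))
    exact ⟨fun x hx => h1 x (mem.2 hx), r, fun x y hx hy => h2 x (mem.2 hx) y (mem.2 hy)⟩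

end

/-! ### Local operators and rigidity -/

section

variable {ι : Type} [DecidableEq ι] {d : ι → ℕ} {P : Finset ι}

/-- The tuple with the coordinates `y` in `P` and `z` outside `P`. -/
def mergeTuple (y : (i : {i // i ∈ P}) → Fin (d i)) (z : (i : {i // i ∉ P}) → Fin (d i)) :
    (i : ι) → Fin (d i) :=
  (Equiv.piEquivPiSubtypeProd (fun i => i ∈ P) fun i => Fin (d i)).symm (y, z)

theorem exists_mergeTuple (P : Finset ι) (x : (i : ι) → Fin (d i)) :
    ∃ y z, x = mergeTuple (P := P) y z :=
  ⟨_, _, ((Equiv.piEquivPiSubtypeProd (fun i => i ∈ P) fun i => Fin (d i)).symm_apply_apply x).symm⟩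

theorem mergeTuple_mem (y : (i : {i // i ∈ P}) → Fin (d i)) (z : (i : {i // i ∉ P}) → Fin (d i))
    (i : {i // i ∈ P}) : mergeTuple y z i = y i := by
  simp [mergeTuple, Equiv.piEquivPiSubtypeProd]

theorem mergeTuple_notMem (y : (i : {i // i ∈ P}) → Fin (d i))
    (z : (i : {i // i ∉ P}) → Fin (d i)) (i : {i // i ∉ P}) : mergeTuple y z i = z i := by
  simp [mergeTuple, Equiv.piEquivPiSubtypeProd, i.2]

variable [Fintype ι]

theorem sum_mergeTuple {R : Type*} [AddCommMonoid R] (f : ((i : ι) → Fin (d i)) → R) :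
    ∑ x, f x = ∑ y, ∑ z, f (mergeTuple (P := P) y z) := by
  rw [← (Equiv.piEquivPiSubtypeProd (fun i => i ∈ P) fun i => Fin (d i)).symm.sum_comp,
    Fintype.sum_prod_type]
  rfl

theorem applyOn_apply (M : GroupOp d P) (ψ : MState d) (x : (i : ι) → Fin (d i)) :
    applyOn M ψ x = ∑ y, M (fun i => x i) y *
      ψ (fun i => if h : i ∈ P then y ⟨i, h⟩ else x i) := rfl

theorem applyOn_mergeTuple (M : GroupOp d P) (ψ : MState d) (y : (i : {i // i ∈ P}) → Fin (d i))
    (z : (i : {i // i ∉ P}) → Fin (d i)) :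
    applyOn M ψ (mergeTuple y z) = ∑ y', M y y' * ψ (mergeTuple y' z) := by
  rw [applyOn_apply]
  refine Finset.sum_congr rfl fun y' _ => ?_
  refine congrArg₂ (· * ·) (congrArg (fun w => M w y') (funext fun i => mergeTuple_mem y z i))
    (congrArg (fun w => ψ w) (funext fun i => ?_))
  by_cases h : i ∈ P
  · rw [dif_pos h]
    exact (mergeTuple_mem y' z ⟨i, h⟩).symm
  · rw [dif_neg h]
    exact (mergeTuple_notMem y z ⟨i, h⟩).trans (mergeTuple_notMem y' z ⟨i, h⟩).symm

theorem applyOn_applyOn (N M : GroupOp d P) (ψ : MState d) :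
    applyOn N (applyOn M ψ) = applyOn (N * M) ψ := by
  ext x
  obtain ⟨y, z, rfl⟩ := exists_mergeTuple P x
  simp only [applyOn_mergeTuple, Matrix.mul_apply, Finset.mul_sum, Finset.sum_mul]
  rw [Finset.sum_comm]
  exact Finset.sum_congr rfl fun _ _ => Finset.sum_congr rfl fun _ _ => by ring

theorem applyOn_comm {P' : Finset ι} (hP : Disjoint P P') (M : GroupOp d P) (N : GroupOp d P')
    (ψ : MState d) : applyOn M (applyOn N ψ) = applyOn N (applyOn M ψ) := by
  have hd : ∀ i, i ∈ P → i ∉ P' := fun i h h' => Finset.disjoint_left.1 hP h h'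
  ext x
  simp only [applyOn_apply, Finset.mul_sum]
  rw [Finset.sum_comm]
  refine Finset.sum_congr rfl fun y' _ => Finset.sum_congr rfl fun y _ => ?_
  have e₁ : (fun i : {i // i ∈ P'} => if h : (i : ι) ∈ P then y ⟨i, h⟩ else x i) =
      fun i : {i // i ∈ P'} => x i := funext fun i => dif_neg fun h => hd i h i.2
  have e₂ : (fun i : {i // i ∈ P} => if h : (i : ι) ∈ P' then y' ⟨i, h⟩ else x i) =
      fun i : {i // i ∈ P} => x i := funext fun i => dif_neg (hd i i.2)
  have e₃ : (fun i => if h : i ∈ P' then y' ⟨i, h⟩ else if h : i ∈ P then y ⟨i, h⟩ else x i) =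
      fun i => if h : i ∈ P then y ⟨i, h⟩ else if h : i ∈ P' then y' ⟨i, h⟩ else x i := by
    funext i
    by_cases h : i ∈ P
    · simp [h, hd i h]
    · simp [h]
  rw [e₁, e₂, e₃]
  ring

/-- The kernel of the quadratic form `ψ ↦ ‖(M ⊗ 𝟙) ψ‖ ^ 2`. -/
noncomputable def measurementKernel (M : GroupOp d P) (x y : (i : ι) → Fin (d i)) : ℂ :=
  if ∀ i, i ∉ P → x i = y i then (Mᴴ * M) (fun i => x i) (fun i => y i) else 0

theorem measurementKernel_mergeTuple (M : GroupOp d P) (y y' : (i : {i // i ∈ P}) → Fin (d i))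
    (z z' : (i : {i // i ∉ P}) → Fin (d i)) :
    measurementKernel M (mergeTuple y z) (mergeTuple y' z') =
      if z = z' then (Mᴴ * M) y y' else 0 := by
  unfold measurementKernel
  refine if_congr ⟨fun h => funext fun i => ?_, fun h i hi => ?_⟩ ?_ rfl
  · rw [← mergeTuple_notMem y z i, h i i.2, mergeTuple_notMem]
  · rw [mergeTuple_notMem y z ⟨i, hi⟩, mergeTuple_notMem y' z' ⟨i, hi⟩, h]
  · rw [funext (mergeTuple_mem y z), funext (mergeTuple_mem y' z')]

theorem inner_eq_sum (ψ φ : MState d) : inner ℂ ψ φ = ∑ x, conj (ψ x) * φ x := by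
  rw [PiLp.inner_apply]
  exact Finset.sum_congr rfl fun x _ => by rw [RCLike.inner_apply, mul_comm]

theorem inner_applyOn (M : GroupOp d P) (ψ φ : MState d) :
    inner ℂ (applyOn M ψ) (applyOn M φ) = sesq (measurementKernel M) ψ φ := by
  rw [inner_eq_sum, sesq, sum_mergeTuple (P := P), sum_mergeTuple (P := P)]
  simp only [sum_mergeTuple (P := P) (fun x => conj _ * measurementKernel M _ x * φ x),
    measurementKernel_mergeTuple, applyOn_mergeTuple]
  rw [Finset.sum_comm, Finset.sum_comm (γ := (i : {i // i ∈ P}) → Fin (d i))]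
  refine Finset.sum_congr rfl fun z _ => ?_
  simp only [mul_ite, mul_zero, ite_mul, zero_mul, Finset.sum_ite_eq, Finset.mem_univ, if_true,
    Matrix.mul_apply, Matrix.conjTranspose_apply, map_sum, map_mul, Finset.sum_mul, Finset.mul_sum]
  conv_rhs => rw [Finset.sum_comm]
  rw [Finset.sum_comm]
  refine Finset.sum_congr rfl fun y _ => ?_
  rw [Finset.sum_comm]
  refine Finset.sum_congr rfl fun y' _ => Finset.sum_congr rfl fun y'' _ => ?_
  simp only [RCLike.star_def]
  ring

theorem measurementKernel_symm (M : GroupOp d P) (x y : (i : ι) → Fin (d i)) :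
    measurementKernel M y x = conj (measurementKernel M x y) := by
  unfold measurementKernel
  have h : (∀ i, i ∉ P → y i = x i) ↔ ∀ i, i ∉ P → x i = y i :=
    forall₂_congr fun i _ => eq_comm
  have hM := (Matrix.isHermitian_conjTranspose_mul_self M).apply (fun i => y i) (fun i => x i)
  simp only [h]
  split_ifs
  · rw [← hM]
    rfl
  · simp

theorem inner_applyOn_of_scalar {M : GroupOp d P} {c : ℂ} (hM : Mᴴ * M = c • 1) (ψ φ : MState d) :
    inner ℂ (applyOn M ψ) (applyOn M φ) = c * inner ℂ ψ φ := by
  have h : ∀ x y : (i : ι) → Fin (d i), measurementKernel M x y = if x = y then c else 0 := by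
    intro x y
    obtain ⟨u, z, rfl⟩ := exists_mergeTuple P x
    obtain ⟨u', z', rfl⟩ := exists_mergeTuple P y
    rw [measurementKernel_mergeTuple, hM, Matrix.smul_apply, Matrix.one_apply]
    have : mergeTuple u z = mergeTuple u' z' ↔ u = u' ∧ z = z' := by
      rw [mergeTuple, mergeTuple, Equiv.apply_eq_iff_eq, Prod.mk.injEq]
    simp only [this, smul_eq_mul]
    by_cases h1 : z = z' <;> by_cases h2 : u = u' <;> simp [h1, h2]
  rw [inner_applyOn, inner_eq_sum, sesq, Finset.mul_sum]
  refine Finset.sum_congr rfl fun x _ => ?_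
  simp only [h, mul_ite, mul_zero, ite_mul, zero_mul, Finset.sum_ite_eq, Finset.mem_univ, if_true]
  ring

/-- Every operator of one of the two sides that keeps the states orthogonal is a multiple of an
isometry. -/
def IsRigid {κ : Type} (T : Finset ι) (ψ : κ → MState d) : Prop :=
  ∀ P : Finset ι, P = T ∨ P = Tᶜ → ∀ N : GroupOp d P,
    (∀ i j, i ≠ j → inner ℂ (applyOn N (ψ i)) (applyOn N (ψ j)) = 0) → ∃ c : ℂ, Nᴴ * N = c • 1

/-- A later operator `N` of the same side is absorbed into `N * M`, and `M` is a multiple of a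
unitary because the dimension is finite. One of the other side commutes with `M`, which only
rescales inner products. -/
theorem IsRigid.applyOn {κ : Type} {T : Finset ι} {ψ : κ → MState d} (h : IsRigid T ψ)
    (hP : P = T ∨ P = Tᶜ) {M : GroupOp d P} {c : ℂ} (hc : c ≠ 0) (hM : Mᴴ * M = c • 1) :
    IsRigid T fun i => applyOn M (ψ i) := by
  intro P' hP' N hN
  by_cases hPP : P' = P
  · subst hPP
    obtain ⟨c', hc'⟩ := h P' hP' (N * M) fun i j hij => by
      simpa only [applyOn_applyOn] using hN i j hij
    have h1 : (c⁻¹ • Mᴴ) * M = 1 := by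
      rw [Matrix.smul_mul, hM, smul_smul, inv_mul_cancel₀ hc, one_smul]
    have h2 : M * (c⁻¹ • Mᴴ) = 1 := mul_eq_one_comm.1 h1
    have h3 : M * Mᴴ = c • 1 := by
      rw [Matrix.mul_smul] at h2
      rw [← h2, smul_smul, mul_inv_cancel₀ hc, one_smul]
    refine ⟨c' / c, ?_⟩
    have h4 : (M * Mᴴ) * (Nᴴ * N) * (M * Mᴴ) = c' • (M * Mᴴ) := by
      calc _ = M * ((N * M)ᴴ * (N * M)) * Mᴴ := by
            rw [Matrix.conjTranspose_mul]
            simp only [Matrix.mul_assoc]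
        _ = _ := by rw [hc', Matrix.mul_smul, Matrix.mul_one, Matrix.smul_mul]
    rw [h3, Matrix.smul_mul, Matrix.one_mul, Matrix.mul_smul, Matrix.mul_one, smul_smul,
      smul_smul] at h4
    have h5 := congrArg (fun A => (c * c)⁻¹ • A) h4
    simp only [smul_smul] at h5
    rw [inv_mul_cancel₀ (mul_ne_zero hc hc), one_smul] at h5
    rw [h5]
    congr 1
    field_simp
  · have hd : Disjoint P P' := by
      rcases hP with rfl | rfl <;> rcases hP' with rfl | rfl
      · exact absurd rfl hPP
      · exact disjoint_compl_right
      · exact disjoint_compl_left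
      · exact absurd rfl hPP
    refine h P' hP' N fun i j hij => ?_
    have := hN i j hij
    rw [← applyOn_comm hd, ← applyOn_comm hd, inner_applyOn_of_scalar hM, mul_eq_zero] at this
    exact this.resolve_left hc

/-- Each outcome multiplies all squared norms by the same constant, so it annihilates all states or
none; in the latter case rigidity passes to the next round. -/
theorem IsRigid.not_canEliminate {κ : Type} {T : Finset ι} {ψ : κ → MState d} (h : IsRigid T ψ)
    (h0 : ∀ i, ψ i ≠ 0) : ¬ CanEliminate T ψ := by
  intro hE
  induction hE with
  | @now ψ P hP m M hM hO k i j hi hj =>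
    obtain ⟨c, hc⟩ := h P hP (M k) (hO k)
    have h1 := inner_applyOn_of_scalar hc (ψ i) (ψ i)
    rw [hi, inner_zero_left, eq_comm, mul_eq_zero] at h1
    have h2 := inner_applyOn_of_scalar hc (ψ j) (ψ j)
    rw [h1.resolve_right (inner_self_ne_zero.2 (h0 i)), zero_mul] at h2
    exact hj (inner_self_eq_zero.1 h2)
  | @later ψ P hP m M hM hO k j hj _ ih =>
    obtain ⟨c, hc⟩ := h P hP (M k) (hO k)
    have hc0 : c ≠ 0 := by
      rintro rfl
      have h2 := inner_applyOn_of_scalar hc (ψ j) (ψ j)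
      rw [zero_mul] at h2
      exact hj (inner_self_eq_zero.1 h2)
    refine ih (h.applyOn hP hc0 hc) fun i (hi : _root_.applyOn (M k) (ψ i) = 0) => ?_
    have h2 := inner_applyOn_of_scalar hc (ψ i) (ψ i)
    rw [hi, inner_zero_left, eq_comm, mul_eq_zero] at h2
    exact h2.elim hc0 (inner_self_ne_zero.2 (h0 i))

end

/-! ### The layered blocks, the states and the cyclic symmetry -/

/-- The coordinates of a quadruple, listed cyclically from the `i`-th one on. -/
noncomputable def rotate (Y : Fin 4 → Type*) (i : Fin 4) :
    (∀ j, Y j) ≃ Y i × Y (i + 1) × Y (i + 2) × Y (i + 3) :=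
  Equiv.ofBijective (fun x => (x i, x (i + 1), x (i + 2), x (i + 3))) <| by
    constructor
    · intro x y h
      simp only [Prod.mk.injEq] at h
      funext j
      have hj : ∀ i j : Fin 4, j = i ∨ j = i + 1 ∨ j = i + 2 ∨ j = i + 3 := by decide
      rcases hj i j with rfl | rfl | rfl | rfl
      exacts [h.1, h.2.1, h.2.2.1, h.2.2.2]
    · rintro ⟨a, b, c, e⟩
      match i with
      | 0 => exact ⟨fun j => match j with | 0 => a | 1 => b | 2 => c | 3 => e, rfl⟩
      | 1 => exact ⟨fun j => match j with | 1 => a | 2 => b | 3 => c | 0 => e, rfl⟩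
      | 2 => exact ⟨fun j => match j with | 2 => a | 3 => b | 0 => c | 1 => e, rfl⟩
      | 3 => exact ⟨fun j => match j with | 3 => a | 0 => b | 1 => c | 2 => e, rfl⟩

theorem rotate_apply {Y : Fin 4 → Type*} (i : Fin 4) (x : ∀ j, Y j) :
    rotate Y i x = (x i, x (i + 1), x (i + 2), x (i + 3)) := rfl

theorem prod_rotate (i : Fin 4) (f : Fin 4 → ℂ) :
    ∏ j, f j = f i * (f (i + 1) * (f (i + 2) * f (i + 3))) := by
  rw [Fin.prod_univ_four]
  match i with
  | 0 => change _ = f 0 * (f 1 * (f 2 * f 3)); ring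
  | 1 => change _ = f 1 * (f 2 * (f 3 * f 0)); ring
  | 2 => change _ = f 2 * (f 3 * (f 0 * f 1)); ring
  | 3 => change _ = f 3 * (f 0 * (f 1 * f 2)); ring

/-- Whether the block with corner `c` extends into the interior in direction `j`. -/
def extendsIn (c : Fin 4 → Bool) (j : Fin 4) : Bool :=
  xor (xor (c j) (c (j + 1))) (j == 3)

/-- The two extreme positions in the `l`-th layer of `{0, …, n - 1}`. -/
def endVal (n l : ℕ) (b : Bool) : ℕ :=
  if b then n - 1 - l else l

/-- The sides of the blocks: those of the layers `0, …, s`, indexed by the corners of a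
hypercube, and that of the remaining central box. -/
def block (d : Fin 4 → ℕ) (s : ℕ) :
    Option (Fin (s + 1) × (Fin 4 → Bool)) → (j : Fin 4) → Finset (Fin (d j))
  | none, j => {x | s < (x : ℕ) ∧ (x : ℕ) < d j - 1 - s}
  | some (l, c), j => {x | (x : ℕ) = endVal (d j) l (c j) ∨
      (extendsIn c j = true ∧ (l : ℕ) < x ∧ (x : ℕ) < d j - 1 - l)}

theorem mem_block_some {d : Fin 4 → ℕ} {s : ℕ} {l : Fin (s + 1)} {c : Fin 4 → Bool} {j : Fin 4}
    {x : Fin (d j)} : x ∈ block d s (some (l, c)) j ↔ (x : ℕ) = endVal (d j) l (c j) ∨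
      (extendsIn c j = true ∧ (l : ℕ) < x ∧ (x : ℕ) < d j - 1 - l) := by
  simp [block]

theorem mem_block_none {d : Fin 4 → ℕ} {s : ℕ} {j : Fin 4} {x : Fin (d j)} :
    x ∈ block d s none j ↔ s < (x : ℕ) ∧ (x : ℕ) < d j - 1 - s := by
  simp [block]

/-- The product Fourier state with frequencies `k` on a box. -/
noncomputable def boxState {d : Fin 4 → ℕ} (R : (j : Fin 4) → Finset (Fin (d j)))
    (k : (j : Fin 4) → ZMod (#(R j) - 1 + 1)) : MState d :=
  WithLp.toLp 2 fun x => ∏ j, fourierVec (R j) (k j) (x j)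

/-- The indices of the states of the unextendible product basis: the nonzero frequencies of all
blocks, and `none` for the stopper. -/
abbrev StateIndex (d : Fin 4 → ℕ) (s : ℕ) : Type :=
  Option (Σ β : Option (Fin (s + 1) × (Fin 4 → Bool)),
    {k : (j : Fin 4) → ZMod (#(block d s β j) - 1 + 1) // k ≠ 0})

/-- The states of the unextendible product basis. -/
noncomputable def basisState (d : Fin 4 → ℕ) (s : ℕ) : StateIndex d s → MState d
  | none => WithLp.toLp 2 fun _ => 1
  | some ⟨β, k⟩ => boxState (block d s β) k

/-- The ends of the `j`-th coordinate, exchanged for the parties before the `i`-th one. -/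
def flippedEnd {d : Fin 4 → ℕ} (hd : ∀ j, 3 ≤ d j) (i j : Fin 4) (b : Bool) : Fin (d j) :=
  ⟨endVal (d j) 0 (xor b (decide (j < i))), by
    have := hd j
    unfold endVal
    split_ifs <;> omega⟩

theorem flippedEnd_injective {d : Fin 4 → ℕ} (hd : ∀ j, 3 ≤ d j) (i j : Fin 4) :
    Function.Injective (flippedEnd hd i j) := by
  intro b b' h
  have := hd j
  simp only [flippedEnd, endVal, Fin.mk.injEq] at h
  revert h
  generalize decide (j < i) = f
  cases b <;> cases b' <;> cases f <;> first | exact fun _ => rfl | (intro h; simp at h; omega)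

theorem mid_ne_flippedEnd {d : Fin 4 → ℕ} (hd : ∀ j, 3 ≤ d j) (i j : Fin 4) (b : Bool) :
    (⟨1, (by norm_num : 1 < 3).trans_le (hd j)⟩ : Fin (d j)) ≠ flippedEnd hd i j b := by
  have := hd j
  simp only [flippedEnd, endVal, ne_eq, Fin.mk.injEq]
  generalize xor b (decide (j < i)) = f
  cases f <;> simp
  omega

/-- The corner of a block, in terms of the ends given by `flippedEnd`. -/
noncomputable def flippedCorner (i : Fin 4) (a b c e : Bool) (j : Fin 4) : Bool :=
  xor ((rotate (fun _ => Bool) i).symm (a, b, c, e) j) (decide (j < i))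

theorem rotate_symm_apply {Y : Fin 4 → Type*} {i : Fin 4}
    (p : Y i × Y (i + 1) × Y (i + 2) × Y (i + 3)) :
    (rotate Y i).symm p i = p.1 ∧ (rotate Y i).symm p (i + 1) = p.2.1 ∧
      (rotate Y i).symm p (i + 2) = p.2.2.1 ∧ (rotate Y i).symm p (i + 3) = p.2.2.2 := by
  have := (rotate Y i).apply_symm_apply p
  rw [rotate_apply] at this
  exact ⟨congrArg Prod.fst this, congrArg (fun q => q.2.1) this, congrArg (fun q => q.2.2.1) this,
    congrArg (fun q => q.2.2.2) this⟩

theorem block_zero_eq_side {d : Fin 4 → ℕ} (hd : ∀ j, 3 ≤ d j) (s : ℕ) (i j : Fin 4)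
    (c : Fin 4 → Bool) :
    block d s (some (0, fun j => xor (c j) (decide (j < i)))) j =
      side (flippedEnd hd i j) (c j) (extendsIn (fun j => xor (c j) (decide (j < i))) j) := by
  have := hd j
  ext x
  have hx := x.2
  rw [mem_block_some]
  unfold side
  generalize extendsIn (fun j => xor (c j) (decide (j < i))) j = ext
  cases ext <;> simp only [Fin.val_zero, if_true, if_false, Bool.false_eq_true, false_and,
    true_and, or_false, Finset.mem_erase, Finset.mem_univ, and_true, Finset.mem_singleton,
    Fin.ext_iff, flippedEnd, endVal, ne_eq] <;>
    (generalize decide (j < i) = f; generalize c j = c; cases c <;> cases f <;> simp <;> omega)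

/-- Exchanging the ends of the parties before the `i`-th moves the twist to the step from `i + 3` to
`i`, so every party can play the role of the first. -/
theorem extendsIn_flipped : ∀ (i : Fin 4) (c : Fin 4 → Bool),
    extendsIn (fun j => xor (c j) (decide (j < i))) i = xor (c i) (c (i + 1)) ∧
    extendsIn (fun j => xor (c j) (decide (j < i))) (i + 1) = xor (c (i + 1)) (c (i + 2)) ∧
    extendsIn (fun j => xor (c j) (decide (j < i))) (i + 2) = xor (c (i + 2)) (c (i + 3)) ∧
    extendsIn (fun j => xor (c j) (decide (j < i))) (i + 3) = !(xor (c (i + 3)) (c i)) := by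
  decide

/-- Frequency types depend on the set, so an equality of sets has to be transported to them. -/
theorem exists_freq_equiv {X : Type*} [DecidableEq X] {S S' : Finset X} (h : S = S') :
    ∃ f : ZMod (#S' - 1 + 1) ≃ ZMod (#S - 1 + 1), f 0 = 0 ∧
      ∀ k, fourierVec S (f k) = fourierVec S' k := by
  subst h
  exact ⟨Equiv.refl _, rfl, fun _ => rfl⟩

/-! ### Reduction of a local operator to a kernel on three parties -/

section

variable {d : Fin 4 → ℕ} (hd : ∀ j, 3 ≤ d j) (s : ℕ) (i : Fin 4)

theorem exists_boxState_eq_of_sides {R : (j : Fin 4) → Finset (Fin (d j))}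
    {eA : Bool → Fin (d i)} {eB : Bool → Fin (d (i + 1))} {eC : Bool → Fin (d (i + 2))}
    {eD : Bool → Fin (d (i + 3))} {a b c e : Bool} (b₀ : R i = side eA a (xor a b))
    (b₁ : R (i + 1) = side eB b (xor b c)) (b₂ : R (i + 2) = side eC c (xor c e))
    (b₃ : R (i + 3) = side eD e (!(xor e a))) :
    ∃ f : ZMod (#(side eA a (xor a b)) - 1 + 1) × BoxFreq eB eC eD a b c e →
        (j : Fin 4) → ZMod (#(R j) - 1 + 1),
      Function.Injective f ∧ f 0 = 0 ∧ ∀ k x, boxState R (f k) x =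
        fourierVec (side eA a (xor a b)) k.1 (x i) *
          boxVec eB eC eD a b c e k.2 (x (i + 1), x (i + 2), x (i + 3)) := by
  obtain ⟨f₀, z₀, h₀⟩ := exists_freq_equiv b₀
  obtain ⟨f₁, z₁, h₁⟩ := exists_freq_equiv b₁
  obtain ⟨f₂, z₂, h₂⟩ := exists_freq_equiv b₂
  obtain ⟨f₃, z₃, h₃⟩ := exists_freq_equiv b₃
  let ρ := rotate (fun j => ZMod (#(R j) - 1 + 1)) i
  refine ⟨fun k => ρ.symm (f₀ k.1, f₁ k.2.1, f₂ k.2.2.1, f₃ k.2.2.2), ?_, ?_, ?_⟩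
  · rintro ⟨k₀, k₁, k₂, k₃⟩ ⟨l₀, l₁, l₂, l₃⟩ h
    simpa using h
  · rw [Equiv.symm_apply_eq]
    simp only [Prod.fst_zero, Prod.snd_zero, z₀, z₁, z₂, z₃]
    rfl
  · rintro ⟨k₀, k₁, k₂, k₃⟩ x
    obtain ⟨q₀, q₁, q₂, q₃⟩ := rotate_symm_apply (Y := fun j => ZMod (#(R j) - 1 + 1)) (i := i)
      (f₀ k₀, f₁ k₁, f₂ k₂, f₃ k₃)
    change ∏ j, fourierVec (R j) (ρ.symm (f₀ k₀, f₁ k₁, f₂ k₂, f₃ k₃) j) (x j) = _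
    rw [prod_rotate i, q₀, q₁, q₂, q₃, h₀, h₁, h₂, h₃]
    rfl

/-- The states of a block of the outer layer, seen from the `i`-th party. -/
theorem exists_boxState_eq (a b c e : Bool) :
    ∃ f : ZMod (#(side (flippedEnd hd i i) a (xor a b)) - 1 + 1) ×
        BoxFreq (flippedEnd hd i (i + 1)) (flippedEnd hd i (i + 2)) (flippedEnd hd i (i + 3))
          a b c e →
        (j : Fin 4) → ZMod (#(block d s (some (0, flippedCorner i a b c e)) j) - 1 + 1),
      Function.Injective f ∧ f 0 = 0 ∧ ∀ k x,
        boxState (block d s (some (0, flippedCorner i a b c e))) (f k) x =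
        fourierVec (side (flippedEnd hd i i) a (xor a b)) k.1 (x i) *
          boxVec (flippedEnd hd i (i + 1)) (flippedEnd hd i (i + 2)) (flippedEnd hd i (i + 3))
            a b c e k.2 (x (i + 1), x (i + 2), x (i + 3)) := by
  set c' := (rotate (fun _ => Bool) i).symm (a, b, c, e) with hc'
  obtain ⟨r₀, r₁, r₂, r₃⟩ := rotate_symm_apply (Y := fun _ => Bool) (i := i) (a, b, c, e)
  obtain ⟨x₀, x₁, x₂, x₃⟩ := extendsIn_flipped i c'
  rw [← hc'] at r₀ r₁ r₂ r₃
  rw [r₀, r₁] at x₀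
  rw [r₁, r₂] at x₁
  rw [r₂, r₃] at x₂
  rw [r₃, r₀] at x₃
  have b₀ := block_zero_eq_side hd s i i c'
  have b₁ := block_zero_eq_side hd s i (i + 1) c'
  have b₂ := block_zero_eq_side hd s i (i + 2) c'
  have b₃ := block_zero_eq_side hd s i (i + 3) c'
  rw [x₀, r₀] at b₀
  rw [x₁, r₁] at b₁
  rw [x₂, r₂] at b₂
  rw [x₃, r₃] at b₃
  exact exists_boxState_eq_of_sides i b₀ b₁ b₂ b₃

/-- The restriction of a kernel to the parties other than the `i`-th one. -/
noncomputable def reducedKernel (F : ((j : Fin 4) → Fin (d j)) → ((j : Fin 4) → Fin (d j)) → ℂ)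
    (p q : Fin (d (i + 1)) × Fin (d (i + 2)) × Fin (d (i + 3))) : ℂ :=
  F ((rotate (fun j => Fin (d j)) i).symm (⟨0, (by norm_num : 0 < 3).trans_le (hd i)⟩, p))
    ((rotate (fun j => Fin (d j)) i).symm (⟨0, (by norm_num : 0 < 3).trans_le (hd i)⟩, q))

variable {i}

/-- The operator is the identity on the `i`-th party; in particular the value 0 fixed in
`reducedKernel` is immaterial. -/
theorem measurementKernel_rotate {P : Finset (Fin 4)} (hi : i ∉ P) (N : GroupOp d P)
    (a a' : Fin (d i)) (p q : Fin (d (i + 1)) × Fin (d (i + 2)) × Fin (d (i + 3))) :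
    measurementKernel N ((rotate (fun j => Fin (d j)) i).symm (a, p))
      ((rotate (fun j => Fin (d j)) i).symm (a', q)) =
      if a = a' then reducedKernel hd i (measurementKernel N) p q else 0 := by
  have hj : ∀ i j : Fin 4, j = i ∨ j = i + 1 ∨ j = i + 2 ∨ j = i + 3 := by decide
  have key : ∀ (a a' : Fin (d i)) p j, j ≠ i → (rotate (fun j => Fin (d j)) i).symm (a, p) j =
      (rotate (fun j => Fin (d j)) i).symm (a', p) j := by
    intro a a' p j hji
    obtain ⟨-, r₁, r₂, r₃⟩ := rotate_symm_apply (Y := fun j => Fin (d j)) (i := i) (a, p)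
    obtain ⟨-, q₁, q₂, q₃⟩ := rotate_symm_apply (Y := fun j => Fin (d j)) (i := i) (a', p)
    rcases hj i j with rfl | rfl | rfl | rfl
    · exact absurd rfl hji
    · exact r₁.trans q₁.symm
    · exact r₂.trans q₂.symm
    · exact r₃.trans q₃.symm
  have hP : ∀ (a a' : Fin (d i)) p, (fun j : {j // j ∈ P} =>
      (rotate (fun j => Fin (d j)) i).symm (a, p) j) = fun j : {j // j ∈ P} =>
      (rotate (fun j => Fin (d j)) i).symm (a', p) j :=
    fun a a' p => funext fun j => key a a' p j fun h => hi (h ▸ j.2)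
  unfold reducedKernel measurementKernel
  set a₀ : Fin (d i) := ⟨0, (by norm_num : 0 < 3).trans_le (hd i)⟩
  rw [hP a a₀ p, hP a' a₀ q]
  by_cases h : a = a'
  · rw [if_pos h]
    have hiff : ∀ j, (rotate (fun j => Fin (d j)) i).symm (a, p) j =
        (rotate (fun j => Fin (d j)) i).symm (a', q) j ↔
        (rotate (fun j => Fin (d j)) i).symm (a₀, p) j =
        (rotate (fun j => Fin (d j)) i).symm (a₀, q) j := by
      intro j
      by_cases hji : j = i
      · subst hji
        rw [(rotate_symm_apply _).1, (rotate_symm_apply _).1, (rotate_symm_apply _).1,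
          (rotate_symm_apply _).1]
        simp [h]
      · rw [key a a₀ p j hji, key a' a₀ q j hji]
    simp only [hiff]
    split_ifs <;> rfl
  · rw [if_neg h, if_neg]
    intro h'
    have := h' i hi
    rw [(rotate_symm_apply _).1, (rotate_symm_apply _).1] at this
    exact h this

theorem sesq_measurementKernel {P : Finset (Fin 4)} (hi : i ∉ P) (N : GroupOp d P)
    {ψ φ : MState d} {u w : Fin (d i) → ℂ}
    {u' w' : Fin (d (i + 1)) × Fin (d (i + 2)) × Fin (d (i + 3)) → ℂ}
    (hψ : ∀ x, ψ x = u (x i) * u' (x (i + 1), x (i + 2), x (i + 3)))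
    (hφ : ∀ x, φ x = w (x i) * w' (x (i + 1), x (i + 2), x (i + 3))) :
    sesq (measurementKernel N) ψ φ = (∑ a, conj (u a) * w a) *
      sesq (reducedKernel hd i (measurementKernel N)) u' w' := by
  have hsplit : ∀ {v : Fin (d i) → ℂ}
      {v' : Fin (d (i + 1)) × Fin (d (i + 2)) × Fin (d (i + 3)) → ℂ} {χ : MState d},
      (∀ x, χ x = v (x i) * v' (x (i + 1), x (i + 2), x (i + 3))) → ∀ a p,
      χ ((rotate (fun j => Fin (d j)) i).symm (a, p)) = v a * v' p := by
    intro v v' χ h a p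
    obtain ⟨r₀, r₁, r₂, r₃⟩ := rotate_symm_apply (Y := fun j => Fin (d j)) (i := i) (a, p)
    rw [h, r₀, r₁, r₂, r₃]
  have hsum : ∀ g : ((j : Fin 4) → Fin (d j)) → ℂ,
      ∑ x, g x = ∑ a, ∑ p, g ((rotate (fun j => Fin (d j)) i).symm (a, p)) := fun g => by
    rw [← (rotate (fun j => Fin (d j)) i).symm.sum_comp, Fintype.sum_prod_type]
  simp only [sesq, hsum, measurementKernel_rotate hd hi, hsplit hψ, hsplit hφ]
  rw [Finset.sum_mul]
  refine Finset.sum_congr rfl fun a _ => ?_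
  rw [Finset.mul_sum]
  refine Finset.sum_congr rfl fun p _ => ?_
  rw [Finset.sum_eq_single a, Finset.mul_sum]
  · refine Finset.sum_congr rfl fun q _ => ?_
    rw [if_pos rfl, map_mul]
    ring
  · intro a' _ ha'
    simp [ha'.symm]
  · simp

/-- An operator of a group of parties that does not contain the `i`-th one and keeps the states of
the basis orthogonal is a multiple of an isometry. -/
theorem exists_conjTranspose_mul_self_eq (hd : ∀ j, 3 ≤ d j) {P : Finset (Fin 4)} (hi : i ∉ P)
    (N : GroupOp d P)
    (hN : ∀ x y : StateIndex d s, x ≠ y →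
      inner ℂ (applyOn N (basisState d s x)) (applyOn N (basisState d s y)) = 0) :
    ∃ t : ℂ, Nᴴ * N = t • 1 := by
  have hf := fun a b c e => exists_boxState_eq hd s i a b c e
  choose f finj fzero fval using hf
  have hcorner : ∀ {a b c e a' b' c' e'}, flippedCorner i a b c e = flippedCorner i a' b' c' e' →
      (a, b, c, e) = (a', b', c', e') := by
    intro a b c e a' b' c' e' h
    refine (rotate (fun _ => Bool) i).symm.injective (funext fun j => ?_)
    have := congrFun h j
    simp only [flippedCorner] at this
    exact (Bool.xor_left_inj).1 this
  have hne : ∀ a b c e k, k ≠ 0 → f a b c e k ≠ 0 := fun a b c e k hk h =>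
    hk (finj a b c e (h.trans (fzero a b c e).symm))
  obtain ⟨t, ht⟩ := kernel_scalar_of_states (flippedEnd_injective hd i i)
    (flippedEnd_injective hd i (i + 1)) (flippedEnd_injective hd i (i + 2))
    (flippedEnd_injective hd i (i + 3)) (mid_ne_flippedEnd hd i i) (mid_ne_flippedEnd hd i (i + 1))
    (mid_ne_flippedEnd hd i (i + 2)) (mid_ne_flippedEnd hd i (i + 3))
    (E := reducedKernel hd i (measurementKernel N))
    (fun x y => measurementKernel_symm N _ _)
    (fun a b c e a' b' c' e' kA k kA' k' h hk hk' => by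
      rw [← sesq_measurementKernel hd hi N (fval a b c e (kA, k)) (fval a' b' c' e' (kA', k')),
        ← inner_applyOn]
      refine hN (some ⟨_, f a b c e (kA, k), hne _ _ _ _ _ hk⟩)
        (some ⟨_, f a' b' c' e' (kA', k'), hne _ _ _ _ _ hk'⟩) fun h' => h ?_
      rw [Option.some.injEq, Sigma.mk.injEq, Option.some.injEq, Prod.mk.injEq] at h'
      exact hcorner h'.1.2)
    (fun a b c e kA kA' k k' h hk hk' => by
      rw [← sesq_measurementKernel hd hi N (fval a b c e (kA, k)) (fval a b c e (kA', k')),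
        ← inner_applyOn]
      refine hN (some ⟨_, f a b c e (kA, k), hne _ _ _ _ _ hk⟩)
        (some ⟨_, f a b c e (kA', k'), hne _ _ _ _ _ hk'⟩) fun h' => h ?_
      rw [Option.some.injEq, Sigma.mk.injEq, heq_eq_eq, Subtype.mk.injEq] at h'
      exact finj _ _ _ _ h'.2)
    (fun a b c e kA k hk => by
      have := sesq_measurementKernel hd hi N (ψ := basisState d s none) (u := fun _ => 1)
        (u' := fun _ => 1) (fun x => by simp [basisState]) (fval a b c e (kA, k))
      simp only [map_one, one_mul] at this
      rw [← this, ← inner_applyOn]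
      exact hN none (some ⟨_, f a b c e (kA, k), hne _ _ _ _ _ hk⟩) (by simp))
  have hK : ∀ x y, measurementKernel N x y = if x = y then t else 0 := by
    intro x y
    have h := measurementKernel_rotate hd hi N (x i) (y i) (x (i + 1), x (i + 2), x (i + 3))
      (y (i + 1), y (i + 2), y (i + 3))
    rw [← rotate_apply i x, ← rotate_apply i y, Equiv.symm_apply_apply, Equiv.symm_apply_apply,
      ht] at h
    rw [h]
    have : x = y ↔ x i = y i ∧ (x (i + 1), x (i + 2), x (i + 3)) =
        (y (i + 1), y (i + 2), y (i + 3)) := by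
      rw [← (rotate (fun j => Fin (d j)) i).apply_eq_iff_eq, rotate_apply, rotate_apply,
        Prod.mk.injEq]
    simp only [this]
    by_cases h1 : x i = y i <;> simp [h1]
  refine ⟨t, ?_⟩
  ext u v
  -- Any fixed coordinates outside `P` recover the entries of `Nᴴ * N` from the kernel.
  let z : (j : {j // j ∉ P}) → Fin (d j) := fun j => ⟨0, (by norm_num : 0 < 3).trans_le (hd j)⟩
  have h := measurementKernel_mergeTuple N u v z z
  rw [if_pos rfl, hK] at h
  rw [← h, Matrix.smul_apply, Matrix.one_apply, smul_eq_mul, mul_ite, mul_one, mul_zero]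
  refine if_congr ?_ rfl rfl
  rw [mergeTuple, mergeTuple, Equiv.apply_eq_iff_eq, Prod.mk.injEq]
  simp

end

/-! ### The blocks partition the grid; orthogonality and counting -/

/-- An end coordinate fixes `c j`; at an interior one, `c j` is the value that makes the block
extend, given `c (j + 1)`. Starting from an end, this determines the corner backwards around the
cycle. -/
theorem exists_corner (t : Fin 4 → Option Bool) (ht : ∃ j, t j ≠ none) :
    ∃ c : Fin 4 → Bool, ∀ j, fits (t j) (c j) (extendsIn c j) = true := by
  have key : ∀ t₀ t₁ t₂ t₃ : Option Bool, (t₀ ≠ none ∨ t₁ ≠ none ∨ t₂ ≠ none ∨ t₃ ≠ none) →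
      ∃ c₀ c₁ c₂ c₃ : Bool, fits t₀ c₀ (xor (xor c₀ c₁) false) = true ∧
        fits t₁ c₁ (xor (xor c₁ c₂) false) = true ∧ fits t₂ c₂ (xor (xor c₂ c₃) false) = true ∧
        fits t₃ c₃ (xor (xor c₃ c₀) true) = true := by
    decide
  obtain ⟨c₀, c₁, c₂, c₃, h₀, h₁, h₂, h₃⟩ := key (t 0) (t 1) (t 2) (t 3) (by
    obtain ⟨j, hj⟩ := ht
    match j with
    | 0 => exact Or.inl hj
    | 1 => exact Or.inr (Or.inl hj)
    | 2 => exact Or.inr (Or.inr (Or.inl hj))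
    | 3 => exact Or.inr (Or.inr (Or.inr hj)))
  refine ⟨![c₀, c₁, c₂, c₃], fun j => ?_⟩
  match j with
  | 0 => exact h₀
  | 1 => exact h₁
  | 2 => exact h₂
  | 3 => exact h₃

/-- A property that passes from each of the four cyclically ordered places to the preceding one
holds everywhere if it holds somewhere. -/
theorem forall_of_cyclic {p : Fin 4 → Prop} (h : ∀ i, p (i + 1) → p i) (hp : ∃ i, p i) (j : Fin 4) :
    p j := by
  obtain ⟨i, hi⟩ := hp
  have h3 : p (i + 3) := h _ (by
    have : i + 3 + 1 = i := by clear * -; revert i; decide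
    rwa [this])
  have h2 : p (i + 2) := h _ (by
    have : i + 2 + 1 = i + 3 := by clear * -; revert i; decide
    rwa [this])
  have h1 : p (i + 1) := h _ (by
    have : i + 1 + 1 = i + 2 := by clear * -; revert i; decide
    rwa [this])
  have hj : j = i ∨ j = i + 1 ∨ j = i + 2 ∨ j = i + 3 := by clear * -; revert i j; decide
  rcases hj with rfl | rfl | rfl | rfl <;> assumption

theorem corner_unique {t : Fin 4 → Option Bool} (ht : ∃ j, t j ≠ none) {c c' : Fin 4 → Bool}
    (h : ∀ j, fits (t j) (c j) (extendsIn c j) = true)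
    (h' : ∀ j, fits (t j) (c' j) (extendsIn c' j) = true) : c = c' := by
  have h1 : ∀ j, t j ≠ none → c j = c' j := by
    intro j hj
    obtain ⟨b, hb⟩ := Option.ne_none_iff_exists'.1 hj
    have e := h j
    have e' := h' j
    rw [hb] at e e'
    simp only [fits, beq_iff_eq] at e e'
    rw [← e, ← e']
  refine funext (forall_of_cyclic (fun i hi => ?_) (ht.imp h1))
  by_cases hn : t i = none
  · have e := h i
    have e' := h' i
    rw [hn] at e e'
    simp only [fits, extendsIn, hi] at e e'
    revert e e'
    generalize c i = x
    generalize c' i = y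
    generalize c' (i + 1) = z
    generalize (i == 3) = w
    clear * -
    revert x y z w
    decide
  · exact h1 i hn

/-- Around the cycle the differences of `c` cancel and the twist remains, so the number of extended
directions is odd. -/
theorem exists_not_extends : ∀ c : Fin 4 → Bool, ∃ j, extendsIn c j = false := by
  decide

section

variable {d : Fin 4 → ℕ} {s : ℕ}

/-- The types of the coordinates of a cell with respect to the `l`-th layer. -/
def layerType (l : ℕ) (x : (j : Fin 4) → Fin (d j)) (j : Fin 4) : Option Bool :=
  if (x j : ℕ) = l then some false else if (x j : ℕ) = d j - 1 - l then some true else none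

theorem mem_block_iff_fits (hd : ∀ j, 2 * s + 3 ≤ d j) {l : Fin (s + 1)} {c : Fin 4 → Bool}
    {x : (j : Fin 4) → Fin (d j)} {j : Fin 4} :
    x j ∈ block d s (some (l, c)) j ↔ ((l : ℕ) ≤ x j ∧ (x j : ℕ) ≤ d j - 1 - l) ∧
      fits (layerType l x j) (c j) (extendsIn c j) = true := by
  have := hd j
  have hl := l.2
  rw [mem_block_some]
  unfold layerType endVal fits
  generalize extendsIn c j = ext
  generalize c j = b
  generalize (x j : ℕ) = y
  by_cases h1 : y = l
  · rw [if_pos h1]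
    cases b <;> cases ext <;> simp <;> omega
  · rw [if_neg h1]
    by_cases h2 : y = d j - 1 - l
    · rw [if_pos h2]
      cases b <;> cases ext <;> simp <;> omega
    · rw [if_neg h2]
      cases b <;> cases ext <;> simp <;> omega

theorem layerType_ne_none {l : ℕ} {x : (j : Fin 4) → Fin (d j)} {j : Fin 4} :
    layerType l x j ≠ none ↔ (x j : ℕ) = l ∨ (x j : ℕ) = d j - 1 - l := by
  unfold layerType
  split_ifs with h1 h2 <;> simp [h1]
  · simp [h2]
  · exact h2

theorem exists_mem_layer (hd : ∀ j, 2 * s + 3 ≤ d j) (l : Fin (s + 1))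
    {x : (j : Fin 4) → Fin (d j)} (hbox : ∀ j, (l : ℕ) ≤ x j ∧ (x j : ℕ) ≤ d j - 1 - l)
    (hend : ∃ j, (x j : ℕ) = l ∨ (x j : ℕ) = d j - 1 - l) :
    ∃ c, ∀ j, x j ∈ block d s (some (l, c)) j := by
  obtain ⟨c, hc⟩ := exists_corner (layerType l x) (by simpa only [layerType_ne_none] using hend)
  exact ⟨c, fun j => (mem_block_iff_fits hd).2 ⟨hbox j, hc j⟩⟩

theorem end_of_mem_layer {l : Fin (s + 1)} {c : Fin 4 → Bool} {x : (j : Fin 4) → Fin (d j)}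
    (h : ∀ j, x j ∈ block d s (some (l, c)) j) :
    ∃ j, (x j : ℕ) = l ∨ (x j : ℕ) = d j - 1 - l := by
  obtain ⟨j, hj⟩ := exists_not_extends c
  have := h j
  rw [mem_block_some, hj] at this
  simp only [Bool.false_eq_true, false_and, or_false, endVal] at this
  refine ⟨j, ?_⟩
  split_ifs at this
  · exact Or.inr this
  · exact Or.inl this

theorem existsUnique_block (hd : ∀ j, 2 * s + 3 ≤ d j) (x : (j : Fin 4) → Fin (d j)) :
    ∃! β, ∀ j, x j ∈ block d s β j := by
  classical
  refine existsUnique_of_exists_of_unique ?_ ?_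
  · by_cases hx : ∀ j, s < (x j : ℕ) ∧ (x j : ℕ) < d j - 1 - s
    · exact ⟨none, fun j => mem_block_none.2 (hx j)⟩
    -- The layer of `x` is its least distance to the boundary over all coordinates.
    · have hex : ∃ l, ∃ j, (x j : ℕ) ≤ l ∨ d j - 1 - l ≤ (x j : ℕ) := by
        push Not at hx
        obtain ⟨j, hj⟩ := hx
        exact ⟨s, j, by omega⟩
      have hle : Nat.find hex ≤ s := by
        push Not at hx
        obtain ⟨j, hj⟩ := hx
        exact Nat.find_min' hex ⟨j, by omega⟩
      have hbox : ∀ j, Nat.find hex ≤ (x j : ℕ) ∧ (x j : ℕ) ≤ d j - 1 - Nat.find hex := by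
        intro j
        have hj := hd j
        have hxj := (x j).2
        rcases Nat.eq_zero_or_eq_succ_pred (Nat.find hex) with h0 | h0
        · omega
        · have := Nat.find_min hex (m := (Nat.find hex).pred) (by omega)
          push Not at this
          have := this j
          omega
      obtain ⟨j, hj⟩ := Nat.find_spec hex
      obtain ⟨c, hc⟩ := exists_mem_layer hd ⟨Nat.find hex, Nat.lt_succ_of_le hle⟩ hbox
        ⟨j, by have := hbox j; simp only; omega⟩
      exact ⟨_, hc⟩
  · have hlt : ∀ (l l' : Fin (s + 1)) c c', (∀ j, x j ∈ block d s (some (l, c)) j) →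
        (∀ j, x j ∈ block d s (some (l', c')) j) → ¬ l < l' := by
      intro l l' c c' h h' hl
      obtain ⟨j, hj⟩ := end_of_mem_layer h
      have h2 := ((mem_block_iff_fits hd).1 (h' j)).1
      have := hd j
      have hl' := l'.2
      rw [Fin.lt_def] at hl
      omega
    have hnone : ∀ (l : Fin (s + 1)) c, (∀ j, x j ∈ block d s (some (l, c)) j) →
        ¬ ∀ j, x j ∈ block d s none j := by
      intro l c h h'
      obtain ⟨j, hj⟩ := end_of_mem_layer h
      have h2 := mem_block_none.1 (h' j)
      have := hd j
      have hl := l.2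
      omega
    rintro (_ | ⟨l, c⟩) (_ | ⟨l', c'⟩) h h'
    · rfl
    · exact absurd h (hnone l' c' h')
    · exact absurd h' (hnone l c h)
    · obtain rfl : l = l' :=
        le_antisymm (not_lt.1 (hlt l' l c' c h' h)) (not_lt.1 (hlt l l' c c' h h'))
      rw [corner_unique (t := layerType l x)
        (by simpa only [layerType_ne_none] using end_of_mem_layer h)
        (fun j => ((mem_block_iff_fits hd).1 (h j)).2)
        (fun j => ((mem_block_iff_fits hd).1 (h' j)).2)]

theorem block_nonempty (hd : ∀ j, 2 * s + 3 ≤ d j) (β : Option (Fin (s + 1) × (Fin 4 → Bool)))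
    (j : Fin 4) : (block d s β j).Nonempty := by
  have := hd j
  rcases β with _ | ⟨l, c⟩
  · exact ⟨⟨s + 1, by omega⟩, mem_block_none.2 ⟨Nat.lt_succ_self s, by simp only; omega⟩⟩
  · have hl := l.2
    refine ⟨⟨endVal (d j) l (c j), ?_⟩, mem_block_some.2 (Or.inl rfl)⟩
    unfold endVal
    split_ifs <;> omega

theorem isFourierSystem_block (hd : ∀ j, 2 * s + 3 ≤ d j)
    (β : Option (Fin (s + 1) × (Fin 4 → Bool))) :
    IsFourierSystem (Fintype.piFinset (block d s β))
      (fun (x : (j : Fin 4) → Fin (d j)) j => residueIndex (block d s β j) (x j))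
      (fun k x => boxState (block d s β) k x) :=
  IsFourierSystem.pi fun j => isFourierSystem_fourierVec (block_nonempty hd β j)

theorem inner_basisState (hd : ∀ j, 2 * s + 3 ≤ d j) {x y : StateIndex d s} (hxy : x ≠ y) :
    inner ℂ (basisState d s x) (basisState d s y) = 0 := by
  have hstopper : ∀ z, inner ℂ (basisState d s none) (basisState d s (some z)) = 0 := by
    rintro ⟨β, k, hk⟩
    rw [inner_eq_sum]
    have := (isFourierSystem_block hd β).sum_eq_zero hk
    simpa [basisState] using this
  rcases x with _ | ⟨β, k, hk⟩ <;> rcases y with _ | ⟨β', k', hk'⟩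
  · exact absurd rfl hxy
  · exact hstopper _
  · rw [← inner_conj_symm, hstopper, map_zero]
  · rw [inner_eq_sum]
    by_cases hβ : β = β'
    · subst hβ
      have := (isFourierSystem_block hd β).orth k k'
      rwa [if_neg fun h => hxy (by subst h; rfl)] at this
    · refine Finset.sum_eq_zero fun z _ => ?_
      by_cases hz : z ∈ Fintype.piFinset (block d s β)
      · have hz' : z ∉ Fintype.piFinset (block d s β') := fun hz' =>
          hβ ((existsUnique_block hd z).unique (Fintype.mem_piFinset.1 hz)
            (Fintype.mem_piFinset.1 hz'))
        have := (isFourierSystem_block hd β').supp k' z hz'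
        simp only [basisState]
        rw [this, mul_zero]
      · have := (isFourierSystem_block hd β).supp k z hz
        simp only [basisState]
        rw [this, map_zero, zero_mul]

theorem basisState_ne_zero (hd : ∀ j, 2 * s + 3 ≤ d j) (x : StateIndex d s) :
    basisState d s x ≠ 0 := by
  rcases x with _ | ⟨β, k, hk⟩
  · intro h
    have := congrArg (fun ψ : MState d => ψ fun j => ⟨0, by have := hd j; omega⟩) h
    simp [basisState] at this
  · intro h
    obtain ⟨z, hz⟩ := (isFourierSystem_block hd β).nonempty
    have := (isFourierSystem_block hd β).ne_zero k hz
    exact this (congrArg (fun ψ : MState d => ψ z) h)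

theorem basisState_injective (hd : ∀ j, 2 * s + 3 ≤ d j) :
    Function.Injective (basisState d s) := by
  intro x y h
  by_contra hxy
  have := inner_basisState hd hxy
  rw [h] at this
  exact basisState_ne_zero hd y (inner_self_eq_zero.1 this)

theorem isProductState_basisState (hd : ∀ j, 2 * s + 3 ≤ d j) (x : StateIndex d s) :
    IsProductState (basisState d s x) := by
  refine ⟨basisState_ne_zero hd x, ?_⟩
  rcases x with _ | ⟨β, k, hk⟩
  · exact ⟨fun j => WithLp.toLp 2 fun _ => 1, fun x => by simp [basisState]⟩
  · exact ⟨fun j => WithLp.toLp 2 (fourierVec (block d s β j) (k j)), fun x => rfl⟩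

/-- Adding the uniform state of each of the `16 * (s + 1) + 1` blocks would give one state per grid
point; the stopper restores one of the missing ones. -/
theorem card_stateIndex (hd : ∀ j, 2 * s + 3 ≤ d j) :
    Fintype.card (StateIndex d s) + 16 * (s + 1) = ∏ j, d j := by
  have h1 : ∀ β, Fintype.card {k : (j : Fin 4) → ZMod (#(block d s β j) - 1 + 1) // k ≠ 0} + 1 =
      #(Fintype.piFinset (block d s β)) := by
    intro β
    rw [← Fintype.card_option, Fintype.card_congr (Equiv.optionSubtypeNe 0), Fintype.card_pi,
      Fintype.card_piFinset]
    refine Finset.prod_congr rfl fun j _ => ?_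
    rw [ZMod.card]
    exact Nat.sub_add_cancel (Finset.card_pos.2 (block_nonempty hd β j))
  have h2 : ∑ β, #(Fintype.piFinset (block d s β)) = ∏ j, d j := by
    have h3 : ∀ x : (j : Fin 4) → Fin (d j),
        ∑ β, (if x ∈ Fintype.piFinset (block d s β) then 1 else 0) = 1 := by
      intro x
      obtain ⟨β, hβ, hu⟩ := existsUnique_block hd x
      rw [Finset.sum_eq_single β, if_pos (Fintype.mem_piFinset.2 hβ)]
      · intro β' _ hne
        exact if_neg fun h => hne (hu β' (Fintype.mem_piFinset.1 h))
      · simp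
    have h4 : ∑ x : (j : Fin 4) → Fin (d j), 1 = ∏ j, d j := by
      simp
    rw [← h4, ← Finset.sum_congr rfl fun x _ => h3 x, Finset.sum_comm]
    refine Finset.sum_congr rfl fun β _ => ?_
    rw [← Finset.card_filter, Finset.filter_mem_eq_inter, Finset.univ_inter]
  rw [← h2, ← Finset.sum_congr rfl fun β _ => h1 β, Finset.sum_add_distrib, Fintype.card_option,
    Fintype.card_sigma]
  simp only [Finset.sum_const, Finset.card_univ, Fintype.card_option, Fintype.card_prod,
    Fintype.card_fin, Fintype.card_fun, Fintype.card_bool, smul_eq_mul, mul_one]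
  ring

end

/-! ### Unextendibility -/

theorem sum_ne_zero_of_const_on_support {X : Type*} [Fintype X] {v : X → ℂ} {k : ℂ}
    (hv : ∃ x, v x ≠ 0) (hk : ∀ x, v x ≠ 0 → v x = k) : ∑ x, v x ≠ 0 := by
  classical
  obtain ⟨x₀, hx₀⟩ := hv
  have h : ∀ x, v x = if v x ≠ 0 then k else 0 := fun x => by
    split_ifs with hx
    · exact hk x hx
    · exact not_not.1 hx
  rw [Finset.sum_congr rfl fun x _ => h x, ← Finset.sum_filter, Finset.sum_const, nsmul_eq_mul]
  refine mul_ne_zero ?_ (hk x₀ hx₀ ▸ hx₀)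
  have : 0 < #{x | v x ≠ 0} := Finset.card_pos.2 ⟨x₀, by simpa using hx₀⟩
  exact_mod_cast this.ne'

section

variable {d : Fin 4 → ℕ} {s : ℕ}

/-- A product function takes different values at two points that differ in one coordinate only if
the factors of that coordinate differ. -/
theorem factor_eq_of_prod_eq {v : (j : Fin 4) → Fin (d j) → ℂ} {x : (j : Fin 4) → Fin (d j)}
    {i : Fin 4} (hx : ∀ j, j ≠ i → v j (x j) ≠ 0) {p q : Fin (d i)}
    (h : ∏ j, v j (Function.update x i p j) = ∏ j, v j (Function.update x i q j)) :
    v i p = v i q := by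
  have key : ∀ p, ∏ j, v j (Function.update x i p j) = v i p * ∏ j ∈ univ.erase i, v j (x j) := by
    intro p
    rw [← Finset.mul_prod_erase _ _ (Finset.mem_univ i), Function.update_self]
    congr 1
    refine Finset.prod_congr rfl fun j hj => ?_
    rw [Function.update_of_ne (Finset.ne_of_mem_erase hj)]
  rw [key, key] at h
  exact mul_right_cancel₀
    (Finset.prod_ne_zero_iff.2 fun j hj => hx j (Finset.ne_of_mem_erase hj)) h

/-- If the `(i + 1)`-st factor does not vanish at an end of a layer, the `i`-th factor is constant on
the points between the ends and one of the ends. -/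
theorem factor_const_of_end (hd : ∀ j, 2 * s + 3 ≤ d j) (l : Fin (s + 1))
    {v : (j : Fin 4) → Fin (d j) → ℂ} (hv : ∀ j, ∃ x, v j x ≠ 0)
    (hbox : ∀ j x, v j x ≠ 0 → (l : ℕ) ≤ x ∧ (x : ℕ) ≤ d j - 1 - l)
    (hconst : ∀ β, ∀ x y : (j : Fin 4) → Fin (d j), (∀ j, x j ∈ block d s β j) →
      (∀ j, y j ∈ block d s β j) → ∏ j, v j (x j) = ∏ j, v j (y j))
    {i : Fin 4} {b : Bool} {z : Fin (d (i + 1))} (hz : (z : ℕ) = endVal (d (i + 1)) l b)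
    (hvz : v (i + 1) z ≠ 0) {p q : Fin (d i)}
    (hp : (p : ℕ) = endVal (d i) l (!(xor b (i == 3)))) (hq : (l : ℕ) < q ∧ (q : ℕ) < d i - 1 - l) :
    v i p = v i q := by
  choose x₀ hx₀ using hv
  have hii : i + 1 ≠ i := by clear * -; revert i; decide
  have hl := l.2
  let x := Function.update x₀ (i + 1) z
  have hx : ∀ j, v j (x j) ≠ 0 := by
    intro j
    by_cases hj : j = i + 1
    · subst hj
      simpa [x] using hvz
    · simpa [x, Function.update_of_ne hj] using hx₀ j
  have hxz : x (i + 1) = z := Function.update_self _ _ _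
  have hpb : (l : ℕ) ≤ p ∧ (p : ℕ) ≤ d i - 1 - l ∧ ((p : ℕ) = l ∨ (p : ℕ) = d i - 1 - l) := by
    have := hd i
    rw [hp]
    unfold endVal
    split_ifs <;> omega
  obtain ⟨c, hc⟩ := exists_mem_layer hd l (x := Function.update x i p) (fun j => by
      by_cases hj : j = i
      · subst hj
        simp only [Function.update_self]
        exact ⟨hpb.1, hpb.2.1⟩
      · rw [Function.update_of_ne hj]
        exact hbox j _ (hx j))
    ⟨i, by simpa only [Function.update_self] using hpb.2.2⟩
  have hend : ∀ (j : Fin 4) (y : Fin (d j)) (b : Bool), (y : ℕ) = endVal (d j) l b →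
      y ∈ block d s (some (l, c)) j → c j = b := by
    intro j y b hy hm
    have := hd j
    rw [mem_block_some, hy] at hm
    unfold endVal at hm
    revert hm
    generalize c j = b'
    generalize extendsIn c j = ext
    cases b <;> cases b' <;> cases ext <;> simp <;> omega
  have hci : c i = !(xor b (i == 3)) := by
    refine hend i p _ hp ?_
    have := hc i
    rwa [Function.update_self] at this
  have hci' : c (i + 1) = b := by
    refine hend (i + 1) z _ hz ?_
    have := hc (i + 1)
    rwa [Function.update_of_ne hii, hxz] at this
  -- The end of `p` was chosen opposite to `b`, up to the twist, precisely so that the block through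
  -- `p` and `z` extends in direction `i`.
  have hext : extendsIn c i = true := by
    unfold extendsIn
    rw [hci, hci']
    generalize (i == 3) = f
    cases b <;> cases f <;> rfl
  refine factor_eq_of_prod_eq (x := x) (fun j _ => hx j) (hconst (some (l, c)) _ _ hc fun j => ?_)
  by_cases hj : j = i
  · subst hj
    rw [Function.update_self, mem_block_some]
    exact Or.inr ⟨hext, hq⟩
  · have := hc j
    rw [Function.update_of_ne hj] at this ⊢
    exact this

/-- A nonzero product function that is constant on all blocks and lives in the box enclosed by a
layer either lives in the box enclosed by the next layer or has factors with nonzero sums. -/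
theorem support_or_sum_ne_zero (hd : ∀ j, 2 * s + 3 ≤ d j) (l : Fin (s + 1))
    {v : (j : Fin 4) → Fin (d j) → ℂ} (hv : ∀ j, ∃ x, v j x ≠ 0)
    (hbox : ∀ j x, v j x ≠ 0 → (l : ℕ) ≤ x ∧ (x : ℕ) ≤ d j - 1 - l)
    (hconst : ∀ β, ∀ x y : (j : Fin 4) → Fin (d j), (∀ j, x j ∈ block d s β j) →
      (∀ j, y j ∈ block d s β j) → ∏ j, v j (x j) = ∏ j, v j (y j)) :
    (∀ j x, v j x ≠ 0 → (l : ℕ) < x ∧ (x : ℕ) < d j - 1 - l) ∨ ∀ j, ∑ x, v j x ≠ 0 := by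
  have hl := l.2
  have hlt : ∀ j b, endVal (d j) l b < d j := fun j b => by
    have := hd j
    unfold endVal
    split_ifs <;> omega
  let E : (j : Fin 4) → Bool → Fin (d j) := fun j b => ⟨endVal (d j) l b, hlt j b⟩
  let m : (j : Fin 4) → Fin (d j) := fun j => ⟨l + 1, by have := hd j; omega⟩
  have hm : ∀ j, (l : ℕ) < m j ∧ (m j : ℕ) < d j - 1 - l := fun j => by
    have := hd j
    simp only [m]
    omega
  have line : ∀ i b, v (i + 1) (E (i + 1) b) ≠ 0 → ∀ q : Fin (d i),
      ((l : ℕ) < q ∧ (q : ℕ) < d i - 1 - l) → v i (E i (!(xor b (i == 3)))) = v i q :=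
    fun i b hb q hq => factor_const_of_end hd l hv hbox hconst rfl hb rfl hq
  have trich : ∀ j x, v j x ≠ 0 → (∃ b, x = E j b) ∨ ((l : ℕ) < x ∧ (x : ℕ) < d j - 1 - l) := by
    intro j x hx
    have := hbox j x hx
    by_cases h1 : (x : ℕ) = l
    · exact Or.inl ⟨false, Fin.ext h1⟩
    by_cases h2 : (x : ℕ) = d j - 1 - l
    · exact Or.inl ⟨true, Fin.ext h2⟩
    · exact Or.inr (by omega)
  by_cases hA : ∃ i, ∀ b, v i (E i b) ≠ 0
  · -- all factors are constant on the box
    right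
    have hstep : ∀ i, (∀ b, v (i + 1) (E (i + 1) b) ≠ 0) → ∀ x, v i x ≠ 0 → v i x = v i (m i) := by
      intro i hi x hx
      rcases trich i x hx with ⟨b, rfl⟩ | hx'
      -- The next factor is nonzero at both ends, so the end that reaches `E i b` can be used.
      · have := line i (!(xor b (i == 3))) (hi _) (m i) (hm i)
        rw [← this]
        congr 2
        generalize (i == 3) = f
        cases b <;> cases f <;> rfl
      · rw [← line i true (hi _) (m i) (hm i), ← line i true (hi _) x hx']
    have hall : ∀ i, ∀ b, v i (E i b) ≠ 0 := by
      refine forall_of_cyclic (p := fun i => ∀ b, v i (E i b) ≠ 0) (fun i hi b => ?_) hA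
      obtain ⟨x, hx⟩ := hv i
      have hmi : v i (m i) ≠ 0 := hstep i hi x hx ▸ hx
      have := line i (!(xor b (i == 3))) (hi _) (m i) (hm i)
      have hb : (!(xor (!(xor b (i == 3))) (i == 3))) = b := by
        generalize (i == 3) = f
        cases b <;> cases f <;> rfl
      rw [hb] at this
      rw [this]
      exact hmi
    exact fun j => sum_ne_zero_of_const_on_support (hv j) (hstep j (hall (j + 1)))
  by_cases hB : ∃ i, ∀ b, v i (E i b) = 0
  · -- all factors vanish at both ends
    left
    -- Vanishing passes from a place to the following one, against the direction of
    -- `forall_of_cyclic`, hence the negated index.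
    have hall : ∀ i, ∀ b, v (-i) (E (-i) b) = 0 := by
      refine forall_of_cyclic (p := fun i => ∀ b, v (-i) (E (-i) b) = 0) (fun i hi b => ?_) ?_
      · have hneg : -(i + 1) + 1 = -i := by clear * -; revert i; decide
        rw [← hneg]
        by_contra hne
        obtain ⟨x, hx⟩ := hv (-(i + 1))
        rcases trich _ x hx with ⟨b', rfl⟩ | hx'
        · exact hx (hi b')
        · exact hx ((line _ b hne x hx').symm.trans (hi _))
      · obtain ⟨i, hi⟩ := hB
        exact ⟨-i, by rwa [neg_neg]⟩
    intro j x hx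
    rcases trich j x hx with ⟨b, rfl⟩ | hx'
    · have := hall (-j) b
      rw [neg_neg] at this
      exact absurd this hx
    · exact hx'
  · right
    -- Now every factor is nonzero at exactly one end. The interior values of the `i`-th equal its
    -- value at `e`, so it is constant on its support, whether or not it vanishes at `e`.
    push Not at hA hB
    intro i
    obtain ⟨b, hb⟩ := hB (i + 1)
    have hline := line i b hb
    revert hline
    generalize (!(xor b (i == 3))) = e
    intro hline
    have hcase : ∀ b', b' = e ∨ b' = !e := by
      clear * -
      revert e
      decide
    by_cases he : v i (E i e) = 0
    · refine sum_ne_zero_of_const_on_support (k := v i (E i !e)) (hv i) fun x hx => ?_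
      rcases trich i x hx with ⟨b', rfl⟩ | hx'
      · rcases hcase b' with rfl | rfl
        · exact absurd he hx
        · rfl
      · exact absurd ((hline x hx').symm.trans he) hx
    · refine sum_ne_zero_of_const_on_support (k := v i (E i e)) (hv i) fun x hx => ?_
      rcases trich i x hx with ⟨b', rfl⟩ | hx'
      · rcases hcase b' with rfl | rfl
        · rfl
        · obtain ⟨b'', hb''⟩ := hA i
          rcases hcase b'' with rfl | rfl
          · exact absurd hb'' he
          · exact absurd hb'' hx
      · exact (hline x hx').symm

theorem sum_factor_ne_zero (hd : ∀ j, 2 * s + 3 ≤ d j)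
    {v : (j : Fin 4) → Fin (d j) → ℂ} (hv : ∀ j, ∃ x, v j x ≠ 0)
    (hconst : ∀ β, ∀ x y : (j : Fin 4) → Fin (d j), (∀ j, x j ∈ block d s β j) →
      (∀ j, y j ∈ block d s β j) → ∏ j, v j (x j) = ∏ j, v j (y j)) (j : Fin 4) :
    ∑ x, v j x ≠ 0 := by
  -- The layers are peeled off one by one; what survives all of them is supported in the central
  -- block.
  have main : ∀ l, l ≤ s + 1 → (∀ j x, v j x ≠ 0 → l ≤ (x : ℕ) ∧ (x : ℕ) ≤ d j - 1 - l) ∨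
      ∀ j, ∑ x, v j x ≠ 0 := by
    intro l
    induction l with
    | zero => exact fun _ => Or.inl fun j x _ => ⟨Nat.zero_le _, by omega⟩
    | succ l ih =>
      intro hl
      rcases ih (by omega) with h | h
      · rcases support_or_sum_ne_zero hd ⟨l, by omega⟩ hv h hconst with h' | h'
        · refine Or.inl fun j x hx => ?_
          have := h' j x hx
          simp only at this
          omega
        · exact Or.inr h'
      · exact Or.inr h
  rcases main (s + 1) le_rfl with h | h
  · have hin : ∀ j x, v j x ≠ 0 → x ∈ block d s none j := by
      intro j x hx
      have := h j x hx
      have := hd j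
      rw [mem_block_none]
      omega
    choose x₀ hx₀ using hv
    refine sum_ne_zero_of_const_on_support (k := v j (x₀ j)) ⟨x₀ j, hx₀ j⟩ fun x hx => ?_
    have hmem : ∀ p, v j p ≠ 0 → ∀ i, Function.update x₀ j p i ∈ block d s none i := by
      intro p hp i
      by_cases hi : i = j
      · subst hi
        rw [Function.update_self]
        exact hin _ _ hp
      · rw [Function.update_of_ne hi]
        exact hin _ _ (hx₀ i)
    exact factor_eq_of_prod_eq (x := x₀) (fun i _ => hx₀ i)
      (hconst none _ _ (hmem x hx) (hmem _ (hx₀ j)))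
  · exact h j

theorem not_isProductState_of_orthogonal (hd : ∀ j, 2 * s + 3 ≤ d j) {φ : MState d}
    (hφ : ∀ x, inner ℂ (basisState d s x) φ = 0) : ¬ IsProductState φ := by
  rintro ⟨hne, v, hv⟩
  have hne' : ∃ x, φ x ≠ 0 := by
    by_contra! h
    exact hne (by ext x; exact h x)
  obtain ⟨x₀, hx₀⟩ := hne'
  rw [hv, Finset.prod_ne_zero_iff] at hx₀
  have hsum : ∀ j, ∑ x, v j x ≠ 0 := by
    refine sum_factor_ne_zero hd (v := fun j => v j) (fun j => ⟨x₀ j, hx₀ j (Finset.mem_univ j)⟩)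
      fun β x y hx hy => ?_
    rw [← hv, ← hv]
    refine (isFourierSystem_block hd β).const (g := fun x => φ x) (fun k hk => ?_)
      (Fintype.mem_piFinset.2 hx) (Fintype.mem_piFinset.2 hy)
    have := hφ (some ⟨β, k, hk⟩)
    rwa [inner_eq_sum] at this
  have h0 := hφ none
  rw [inner_eq_sum] at h0
  simp only [basisState, map_one, one_mul, hv] at h0
  rw [← Fintype.prod_sum (fun j (x : Fin (d j)) => v j x)] at h0
  exact Finset.prod_ne_zero_iff.2 (fun j _ => hsum j) h0

end

/-! ### The main theorem -/

theorem theorem3 (d : Fin 4 → ℕ) (hA : 3 ≤ d 0) (hAB : d 0 ≤ d 1) (hBC : d 1 ≤ d 2)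
    (hCD : d 2 ≤ d 3) (s : ℕ) (hs : s ≤ (d 0 - 3) / 2) :
    ∃ U : Finset (MState d),
      IsUPB U ∧ IsStronglyNonlocal U ∧
        (U.card : ℤ) = (d 0 : ℤ) * d 1 * d 2 * d 3 - 16 * (s + 1) := by
  classical
  -- This is the condition that the central box is nonempty in each direction.
  have hd : ∀ j, 2 * s + 3 ≤ d j := by
    intro j
    match j with
    | 0 => omega
    | 1 => omega
    | 2 => omega
    | 3 => omega
  have hd3 : ∀ j, 3 ≤ d j := fun j => by have := hd j; omega
  have hmem : ∀ ψ, ψ ∈ univ.image (basisState d s) ↔ ∃ x, basisState d s x = ψ := by simp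
  have hcard : #(univ.image (basisState d s)) + 16 * (s + 1) = ∏ j, d j := by
    rw [Finset.card_image_of_injective _ (basisState_injective hd), Finset.card_univ,
      card_stateIndex hd]
  refine ⟨univ.image (basisState d s), ⟨⟨?_, ?_⟩, ?_, ?_⟩, ?_, ?_⟩
  · intro ψ hψ
    obtain ⟨x, rfl⟩ := (hmem ψ).1 hψ
    exact isProductState_basisState hd x
  · intro ψ hψ φ hφ hne
    obtain ⟨x, rfl⟩ := (hmem ψ).1 hψ
    obtain ⟨y, rfl⟩ := (hmem φ).1 hφ
    exact inner_basisState hd fun h => hne (h ▸ rfl)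
  · intro htop
    have h1 := finrank_span_finset_le_card (R := ℂ) (univ.image (basisState d s))
    rw [Set.finrank, htop, finrank_top, finrank_euclideanSpace, Fintype.card_pi] at h1
    simp only [Fintype.card_fin] at h1
    omega
  · intro φ hφ
    refine not_isProductState_of_orthogonal hd fun x => ?_
    exact (Submodule.mem_orthogonal _ _).1 hφ _
      (Submodule.subset_span (Finset.mem_coe.2 ((hmem _).2 ⟨x, rfl⟩)))
  · intro T hT hT'
    refine IsRigid.not_canEliminate ?_ ?_
    · intro P hP N hN
      obtain ⟨i, hi⟩ : ∃ i, i ∉ P := by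
        rcases hP with rfl | rfl
        · obtain ⟨i, hi⟩ := hT'
          exact ⟨i, Finset.mem_compl.1 hi⟩
        · obtain ⟨i, hi⟩ := hT
          exact ⟨i, fun h => Finset.mem_compl.1 h hi⟩
      refine exists_conjTranspose_mul_self_eq s hd3 hi N fun x y hxy => ?_
      exact hN ⟨_, (hmem _).2 ⟨x, rfl⟩⟩ ⟨_, (hmem _).2 ⟨y, rfl⟩⟩ fun h =>
        hxy (basisState_injective hd (congrArg Subtype.val h))
    · rintro ⟨ψ, hψ⟩
      obtain ⟨x, rfl⟩ := (hmem ψ).1 hψ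
      exact basisState_ne_zero hd x
  · rw [Fin.prod_univ_four] at hcard
    have := congrArg (Nat.cast : ℕ → ℤ) hcard
    push_cast at this
    linarith
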